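/- A $d$-polytope is a $d$-dimensional convex hull of a finite set of points in some $\mathbb{R}^n$; $f_k(P)$ is the number of its $k$-dimensional faces ($k\ge 0$; the polytope is a face of itself), and its facets are its $(d-1)$-faces. Let $T(m)$ be the $m$-simplex, let $\oplus$ be the direct sum of polytopes with the origin in their relative interiors, i.e. $P\oplus P'=\operatorname{conv}\big((P\times\{0\})\cup(\{0\}\times P')\big)$, and let $T_2^{d,d-a}$ be the $(d-a)$-fold pyramid over $T(2)\oplus T(a-2)$. Let $(T_2^{d,d-a})^*$ be its dual polytope (the polar of a realisation with the origin in its interior, and, up to combinatorial equivalence, any $d$-polytope with the same face lattice). Let $d\ge 4$, $2\le s\le d-2$, $a=\lfloor (d+s)/2\rfloor+1$ and $k\ge 0$. Then $(T_2^{d,d-a})^*$ is a $d$-polytope, and $$f_k\big((T_2^{d,d-a})^*\big)=\tau_k(2d+s-1,d),$$ where $$\tau_k(2d+s-1,d):=\binom{d+2}{k+2}-\binom{d-a+3}{k+2}-\binom{d-1}{k+2}+\binom{d-a+1}{k+2}$$ $$=\binom{d+1}{k+1}+\binom{d}{k+1}+\binom{d-1}{k+1}-\binom{d-a+2}{k+1}-\binom{d-a+1}{k+1}.$$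 Moreover, every $d$-polytope $Q$ with exactly $d+2$ facets and at least $2d+s-1$ vertices satisfies $f_k(Q)\ge\tau_k(2d+s-1,d)$. -/

import Mathlib

/-- The dimension of (the affine hull of) a nonempty subset of a real vector space. -/
noncomputable def affDim {E : Type*} [AddCommGroup E] [Module ℝ E] (P : Set E) : ℕ :=
  Module.finrank ℝ (vectorSpan ℝ P)

/-- `P ⊆ ℝⁿ` is a `d`-polytope: the convex hull of a nonempty finite set, of dimension `d`.
The ambient dimension `n` may be larger than `d`. -/
def IsPolytopeOfDim {n : ℕ} (d : ℕ) (P : Set (EuclideanSpace ℝ (Fin n))) : Prop :=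
  (∃ V : Finset (EuclideanSpace ℝ (Fin n)), V.Nonempty ∧
    P = convexHull ℝ (V : Set (EuclideanSpace ℝ (Fin n)))) ∧ affDim P = d

/-- The number `f_k(P)` of `k`-dimensional faces of `P`. A nonempty face is the set of maximisers
over `P` of a linear functional (`P` itself is included, by the zero functional). -/
noncomputable def faceCount {n : ℕ} (k : ℕ) (P : Set (EuclideanSpace ℝ (Fin n))) : ℕ :=
  Set.ncard {F : Set (EuclideanSpace ℝ (Fin n)) |
    F.Nonempty ∧ IsExposed ℝ P F ∧ affDim F = k}

/-- The face lattice of `P` (including `∅` and `P`), ordered by inclusion. -/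
abbrev FaceLattice {n : ℕ} (P : Set (EuclideanSpace ℝ (Fin n))) : Type :=
  {F : Set (EuclideanSpace ℝ (Fin n)) // IsExposed ℝ P F}

/-- Combinatorial equivalence: the face lattices are isomorphic. -/
def CombEquiv {n m : ℕ} (P : Set (EuclideanSpace ℝ (Fin n)))
    (Q : Set (EuclideanSpace ℝ (Fin m))) : Prop :=
  Nonempty (FaceLattice P ≃o FaceLattice Q)

/-- The `m`-simplex `T(m)` in `ℝᵐ`, with vertices `e₁, …, e_m` and `-(e₁ + ⋯ + e_m)`,
so that the origin is an interior point. -/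
noncomputable def simplexT (m : ℕ) : Set (EuclideanSpace ℝ (Fin m)) :=
  convexHull ℝ (insert (-∑ i, EuclideanSpace.single i (1 : ℝ))
    (Set.range fun i : Fin m => EuclideanSpace.single i (1 : ℝ)))

/-- The direct sum `P ⊕ Q = conv ({(p, 0)} ∪ {(0, q)})`, for polytopes with the origin in their
relative interiors. -/
noncomputable def directSum {m n : ℕ} (P : Set (EuclideanSpace ℝ (Fin m)))
    (Q : Set (EuclideanSpace ℝ (Fin n))) : Set (EuclideanSpace ℝ (Fin (m + n))) :=
  convexHull ℝ
    ((fun p : EuclideanSpace ℝ (Fin m) =>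
        WithLp.toLp 2 (Fin.append (WithLp.ofLp p) (0 : Fin n → ℝ))) '' P ∪
     (fun q : EuclideanSpace ℝ (Fin n) =>
        WithLp.toLp 2 (Fin.append (0 : Fin m → ℝ) (WithLp.ofLp q))) '' Q)

/-- The pyramid over `P`: the convex hull of the copy `P × {-1}` of `P` in the hyperplane of height
`-1` and the apex `(0, 1)`. If the origin is interior to `P`, then it is interior to the pyramid. -/
noncomputable def pyramid {n : ℕ} (P : Set (EuclideanSpace ℝ (Fin n))) :
    Set (EuclideanSpace ℝ (Fin (n + 1))) :=
  convexHull ℝ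
    (insert (WithLp.toLp 2 (Fin.snoc (α := fun _ => ℝ) (0 : Fin n → ℝ) (1 : ℝ)))
      ((fun p : EuclideanSpace ℝ (Fin n) =>
        WithLp.toLp 2 (Fin.snoc (α := fun _ => ℝ) (WithLp.ofLp p) (-1 : ℝ))) '' P))

/-- The `r`-fold pyramid over `P`. -/
noncomputable def iterPyramid {n : ℕ} (P : Set (EuclideanSpace ℝ (Fin n))) :
    (r : ℕ) → Set (EuclideanSpace ℝ (Fin (n + r)))
  | 0 => P
  | r + 1 => pyramid (iterPyramid P r)

/-- The polytope `T_m^{d,d-a}`: the `(d-a)`-fold pyramid over `T(m) ⊕ T(a-m)`. For `m ≤ a ≤ d` the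
ambient dimension `m + (a - m) + (d - a)` is `d`, and the origin is an interior point. -/
noncomputable def polyT (m d a : ℕ) : Set (EuclideanSpace ℝ (Fin (m + (a - m) + (d - a)))) :=
  iterPyramid (directSum (simplexT m) (simplexT (a - m))) (d - a)

/-- The dual polytope of a polytope `P` with the origin in its interior. -/
def dualPolytope {n : ℕ} (P : Set (EuclideanSpace ℝ (Fin n))) : Set (EuclideanSpace ℝ (Fin n)) :=
  {y | ∀ x ∈ P, inner ℝ x y ≤ (1 : ℝ)}

/-- The number `τ_k(2d+s-1, d)`, where `a = ⌊(d+s)/2⌋ + 1` (used for `a ≤ d`). -/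
def tau (k d s : ℕ) : ℤ :=
  let a := (d + s) / 2 + 1
  ((d + 2).choose (k + 2) : ℤ) - ((d - a + 3).choose (k + 2) : ℤ)
    - ((d - 1).choose (k + 2) : ℤ) + ((d - a + 1).choose (k + 2) : ℤ)

/-!
A `d`-polytope with `d + 2` facets is, up to an affine isomorphism, the section of a
`(d + 1)`-simplex by a hyperplane. Indeed, let `⟪y i, x⟫ ≤ 1` be its `d + 2` inequalities, with the
origin in the interior. Boundedness gives a strictly positive dependence `∑ c i • y i = 0`, and by
counting dimensions there is a nonzero `l` with `∑ l i = 0` and `∑ l i • y i = 0`. The weighted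
slacks `z i = c i * (1 - ⟪y i, x⟫)` then identify the polytope with
`{z | z ≥ 0, ∑ z i = 1, ∑ μ i * z i = 0}` for `μ = l / c`
(`affinelyIsomorphic_simplexSection`). The signs of `μ` are those of a one-dimensional Gale diagram.

The faces of such a section correspond to the supports of its points, that is, to the balanced sets
of coordinates: those which meet the positive part of `μ` if and only if they meet the negative part
(`nonempty_orderIso_simplexSection`). No dimension of a face has to be computed: exposed faces have
strictly increasing dimensions along chains, and every balanced set lies on a chain of length
`d + 1` from the empty set to the whole set, so in any `d`-polytope with this face lattice the
dimension is the rank of the balanced set (`affDim_add_one_eq_balancedRank`). This also handles all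
realisations of a combinatorial type at once. Inclusion and exclusion turns the count of balanced
sets of given rank into `galeFaceCount k d p q`, where `p` and `q` are the numbers of positive and
negative entries of `μ` (`faceCount_eq_galeFaceCount`).

The vertices of `T(2) ⊕ T(a - 2)` and of its pyramids have an affine dependence with `3` positive
and `a - 1` negative coefficients (`hasGaleData_polyT`), and these vertices are the normal vectors
of the dual polytope; hence its face numbers are `galeFaceCount k d 3 (a - 1) = tau k d s`.

For an arbitrary polytope `Q` with `d + 2` facets and the origin in its interior, the normal
vectors are the extreme points of the polar: by the Krein–Milman theorem they suffice to define `Q`,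
and different ones give different facets (`exists_eq_setOf_inner_le_one`). They may be indexed with
repetitions by `d + 2` indices, which is harmless for the slack map.

It remains to compare face numbers. With `x = p - 1` and `y = q - 1` the number of `k`-faces is a
constant plus the sum of `(d - 1 - (i + j)).choose k` over the rectangle `i < x`, `j < y`; in
particular there are `d + 1 + x * y` vertices, and the hypothesis on the vertices says that the area
`x * y` is at least `d + s - 2`, which is at least the area of the rectangle `2 × (a - 2)`. Among
rectangles with sides at least two, the flat one fills the antidiagonals most slowly, and the
summand decreases with the antidiagonal, so the flat one has the smallest sum (`sum_rectangle_le`).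
-/

open Finset

/-! ### Sums over rectangles and the arithmetic of the bound -/

/-- Summation by parts for an antitone sequence, with the terms cut off at `n` by an indicator. -/
theorem antitone_eq_add_sum_ite (g : ℕ → ℕ) (hg : Antitone g) {n T : ℕ} (hn : n ≤ T) :
    g n = g T + ∑ t ∈ range T, if n ≤ t then g t - g (t + 1) else 0 := by
  induction T, hn using Nat.le_induction with
  | base =>
    rw [sum_eq_zero, add_zero]
    intro t ht
    rw [if_neg (by simpa using ht)]
  | succ m hm ih =>
    have := hg (Nat.le_add_right m 1)
    rw [sum_range_succ, if_pos hm]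
    omega

theorem sum_antitone_eq_layers {α : Type*} (A : Finset α) (u : α → ℕ) (g : ℕ → ℕ)
    (hg : Antitone g) {T : ℕ} (hT : ∀ x ∈ A, u x ≤ T) :
    ∑ x ∈ A, g (u x)
      = #{x ∈ A | u x ≤ T} * g T + ∑ t ∈ range T, #{x ∈ A | u x ≤ t} * (g t - g (t + 1)) := by
  rw [sum_congr rfl fun x hx => antitone_eq_add_sum_ite g hg (hT x hx), sum_add_distrib, sum_comm,
    filter_true_of_mem hT]
  simp [← sum_filter]

/-- If up to every level `A` has at least as many members as `B`, then an antitone weight of the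
level has the larger sum over `A`. -/
theorem sum_antitone_le_of_card_le {α β : Type*} (A : Finset α) (B : Finset β)
    (u : α → ℕ) (w : β → ℕ) (g : ℕ → ℕ) (hg : Antitone g)
    (h : ∀ t, #{x ∈ B | w x ≤ t} ≤ #{x ∈ A | u x ≤ t}) :
    ∑ x ∈ B, g (w x) ≤ ∑ x ∈ A, g (u x) := by
  rw [sum_antitone_eq_layers A u g hg (T := A.sup u + B.sup w)
      fun x hx => (le_sup (f := u) hx).trans (Nat.le_add_right _ _),
    sum_antitone_eq_layers B w g hg (T := A.sup u + B.sup w)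
      fun x hx => (le_sup (f := w) hx).trans (Nat.le_add_left _ _)]
  exact add_le_add (Nat.mul_le_mul_right _ (h _))
    (sum_le_sum fun t _ => Nat.mul_le_mul_right _ (h t))

/-- An `x × y` rectangle of lattice points has at least two points on each antidiagonal strictly
between its two corners, hence at least `2t + 1` points up to the `t`-th antidiagonal. -/
theorem two_mul_add_one_le_card_rectangle {x y t : ℕ} (hx : 2 ≤ x) (hy : 2 ≤ y)
    (ht : t + 3 ≤ x + y) :
    2 * t + 1 ≤ #{c ∈ range x ×ˢ range y | c.1 + c.2 ≤ t} := by
  -- two monotone lattice paths along the two sides of the boundary of the rectangle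
  let f : ℕ → ℕ × ℕ := fun u => (u - (y - 1), min u (y - 1))
  let h : ℕ → ℕ × ℕ := fun u => (min (u + 1) (x - 1), u + 1 - (x - 1))
  have hf : Set.InjOn f (range (t + 1)) := fun u _ v _ e => by
    simp only [f, Prod.mk.injEq] at e; omega
  have hh : Set.InjOn h (range t) := fun u _ v _ e => by
    simp only [h, Prod.mk.injEq] at e; omega
  have hdis : Disjoint ((range (t + 1)).image f) ((range t).image h) := by
    rw [disjoint_left]
    simp only [mem_image, mem_range, not_exists, not_and, forall_exists_index, and_imp, f, h]
    rintro _ u hu rfl v hv e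
    simp only [Prod.mk.injEq] at e
    omega
  have hcard := card_union_of_disjoint hdis
  rw [card_image_of_injOn hf, card_image_of_injOn hh, card_range, card_range] at hcard
  have hsub : (range (t + 1)).image f ∪ (range t).image h
      ⊆ {c ∈ range x ×ˢ range y | c.1 + c.2 ≤ t} := by
    intro c hc
    simp only [mem_union, mem_image, mem_range, f, h] at hc
    simp only [mem_filter, mem_product, mem_range]
    rcases hc with ⟨u, hu, rfl⟩ | ⟨u, hu, rfl⟩ <;> simp only <;> omega
  have := card_le_card hsub
  omega

/-- Among rectangles of sides at least two, the flat one `2 × b` has the smallest sum of an antitone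
function of the antidiagonal, as soon as its area is not larger. -/
theorem sum_rectangle_le {x y b : ℕ} (hx : 2 ≤ x) (hy : 2 ≤ y) (hb : 2 * b ≤ x * y)
    (g : ℕ → ℕ) (hg : Antitone g) :
    ∑ c ∈ range 2 ×ˢ range b, g (c.1 + c.2) ≤ ∑ c ∈ range x ×ˢ range y, g (c.1 + c.2) := by
  refine sum_antitone_le_of_card_le _ _ (fun c : ℕ × ℕ => c.1 + c.2)
    (fun c : ℕ × ℕ => c.1 + c.2) g hg fun t => ?_
  by_cases ht : t + 3 ≤ x + y
  · refine le_trans ?_ (two_mul_add_one_le_card_rectangle hx hy ht)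
    have hsub : {c ∈ range 2 ×ˢ range b | c.1 + c.2 ≤ t}
        ⊆ (range (t + 1)).image (fun l => (0, l)) ∪ (range t).image (fun l => (1, l)) := by
      rintro ⟨i, l⟩ hc
      simp only [mem_filter, mem_product, mem_range] at hc
      simp only [mem_union, mem_image, mem_range, Prod.mk.injEq, exists_eq_right_right]
      omega
    refine (card_le_card hsub).trans ((card_union_le _ _).trans ?_)
    refine (add_le_add card_image_le card_image_le).trans ?_
    simp only [card_range]
    omega
  · rw [filter_true_of_mem (s := range x ×ˢ range y)]
    · refine (card_filter_le _ _).trans ?_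
      simpa using hb
    · rintro ⟨i, l⟩ hc
      simp only [mem_product, mem_range] at hc ⊢
      omega

/-- The number of `k`-faces of a `d`-polytope with `d + 2` facets whose Gale diagram has `p`
positive and `q` negative vectors. -/
def galeFaceCount (k d p q : ℕ) : ℤ :=
  ((d + 2).choose (k + 2) : ℤ) - ((d + 2 - p).choose (k + 2) : ℤ)
    - ((d + 2 - q).choose (k + 2) : ℤ) + ((d + 3 - p - q).choose (k + 2) : ℤ)

/-- A partial column sum of the Pascal triangle. -/
theorem sum_choose_sub (M y k : ℕ) (hy : y ≤ M) :
    (∑ l ∈ range y, ((M - 1 - l).choose k : ℤ))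
      = (M.choose (k + 1) : ℤ) - ((M - y).choose (k + 1) : ℤ) := by
  induction y with
  | zero => simp
  | succ y ih =>
    rw [sum_range_succ, ih (by omega)]
    obtain ⟨m, rfl⟩ : ∃ m, M = m + y + 1 := ⟨M - y - 1, by omega⟩
    rw [show m + y + 1 - y = m + 1 by omega, show m + y + 1 - 1 - y = m by omega,
      show m + y + 1 - (y + 1) = m by omega, Nat.choose_succ_succ m k]
    push_cast
    ring

/-- The face number as a sum over a rectangle. -/
theorem galeFaceCount_eq_sum (k d x y : ℕ) (h : x + y ≤ d) :
    galeFaceCount k d (x + 1) (y + 1)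
      = ((d + 1).choose (k + 1) : ℤ)
        + ((∑ c ∈ range x ×ˢ range y, (d - 1 - (c.1 + c.2)).choose k : ℕ) : ℤ) := by
  rw [sum_product]
  push_cast
  have h1 : ∀ i ∈ range x, (∑ l ∈ range y, ((d - 1 - (i + l)).choose k : ℤ))
      = ((d + 1 - 1 - i).choose (k + 1) : ℤ) - ((d + 1 - y - 1 - i).choose (k + 1) : ℤ) := by
    intro i hi
    rw [mem_range] at hi
    rw [show d + 1 - y - 1 - i = (d - i) - y by omega, show d + 1 - 1 - i = d - i by omega,
      ← sum_choose_sub (d - i) y k (by omega)]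
    refine sum_congr rfl fun l _ => ?_
    rw [show d - 1 - (i + l) = d - i - 1 - l by omega]
  rw [sum_congr rfl h1, sum_sub_distrib, sum_choose_sub (d + 1) x (k + 1) (by omega),
    sum_choose_sub (d + 1 - y) x (k + 1) (by omega)]
  unfold galeFaceCount
  rw [show d + 2 - (x + 1) = d + 1 - x by omega, show d + 2 - (y + 1) = d + 1 - y by omega,
    show d + 3 - (x + 1) - (y + 1) = d + 1 - y - x by omega, Nat.choose_succ_succ (d + 1) (k + 1)]
  push_cast
  ring

theorem galeFaceCount_zero (d x y : ℕ) (h : x + y ≤ d) :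
    galeFaceCount 0 d (x + 1) (y + 1) = d + 1 + x * y := by
  rw [galeFaceCount_eq_sum 0 d x y h]
  simp

theorem tau_eq_galeFaceCount (k d s a : ℕ) (hs : 2 ≤ s) (hsd : s + 2 ≤ d)
    (ha : a = (d + s) / 2 + 1) : tau k d s = galeFaceCount k d 3 (a - 1) := by
  simp only [tau, galeFaceCount, ← ha]
  rw [show d + 2 - 3 = d - 1 by omega, show d + 2 - (a - 1) = d - a + 3 by omega,
    show d + 3 - 3 - (a - 1) = d - a + 1 by omega]
  ring

theorem tau_eq_choose_succ (k d s a : ℕ) (hs : 2 ≤ s) (hsd : s + 2 ≤ d)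
    (ha : a = (d + s) / 2 + 1) :
    tau k d s = ((d + 1).choose (k + 1) : ℤ) + (d.choose (k + 1) : ℤ)
        + ((d - 1).choose (k + 1) : ℤ) - ((d - a + 2).choose (k + 1) : ℤ)
        - ((d - a + 1).choose (k + 1) : ℤ) := by
  simp only [tau, ← ha]
  obtain ⟨e, rfl⟩ : ∃ e, d = e + 1 := ⟨d - 1, by omega⟩
  simp only [Nat.add_sub_cancel]
  generalize e + 1 - a = m
  rw [Nat.choose_succ_succ (e + 1 + 1) (k + 1), Nat.choose_succ_succ (e + 1) (k + 1),
    Nat.choose_succ_succ e (k + 1), Nat.choose_succ_succ (m + 2) (k + 1),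
    Nat.choose_succ_succ (m + 1) (k + 1)]
  push_cast
  ring

/-- With at least as many vertices as prescribed, the face numbers are at least `tau`: the rectangle
`(p - 1) × (q - 1)` has at least the area of the flat rectangle that belongs to `tau`. -/
theorem tau_le_galeFaceCount (k d s p q : ℕ) (hs : 2 ≤ s) (hsd : s + 2 ≤ d)
    (hp : 1 ≤ p) (hq : 1 ≤ q) (hpq : p + q ≤ d + 2)
    (h0 : 2 * (d : ℤ) + s - 1 ≤ galeFaceCount 0 d p q) :
    tau k d s ≤ galeFaceCount k d p q := by
  obtain ⟨x, rfl⟩ : ∃ x, p = x + 1 := ⟨p - 1, by omega⟩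
  obtain ⟨y, rfl⟩ : ∃ y, q = y + 1 := ⟨q - 1, by omega⟩
  have hxy : x + y ≤ d := by omega
  rw [galeFaceCount_zero d x y hxy] at h0
  have h1 : d + s ≤ x * y + 2 := by zify; linarith
  -- a side of length at most one would need `d` cells along the other side, against `x + y ≤ d`
  have hx : 2 ≤ x := by
    by_contra hx
    interval_cases x <;> omega
  have hy : 2 ≤ y := by
    by_contra hy
    interval_cases y <;> omega
  rw [tau_eq_galeFaceCount k d s _ hs hsd rfl,
    show (d + s) / 2 + 1 - 1 = ((d + s) / 2 - 1) + 1 by omega,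
    galeFaceCount_eq_sum k d 2 _ (by omega), galeFaceCount_eq_sum k d x y hxy]
  have := sum_rectangle_le hx hy (b := (d + s) / 2 - 1) (by omega)
    (fun t => (d - 1 - t).choose k) fun m n hmn => Nat.choose_le_choose k (by omega)
  have : ((∑ c ∈ range 2 ×ˢ range ((d + s) / 2 - 1), (d - 1 - (c.1 + c.2)).choose k : ℕ) : ℤ)
    ≤ ((∑ c ∈ range x ×ˢ range y, (d - 1 - (c.1 + c.2)).choose k : ℕ) : ℤ) := by
    exact_mod_cast this
  linarith

/-! ### Balanced sets -/

/-- A set of coordinates is balanced if it contains a positive coefficient of `μ` exactly when it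
contains a negative one. These are the supports of the nonnegative vectors orthogonal to `μ`. -/
def IsBalanced {ι : Type*} (μ : ι → ℝ) (S : Finset ι) : Prop :=
  (∃ i ∈ S, 0 < μ i) ↔ ∃ i ∈ S, μ i < 0

open Classical in
/-- The rank of a balanced set: one more than the dimension of the corresponding face. -/
noncomputable def balancedRank {ι : Type*} (μ : ι → ℝ) (S : Finset ι) : ℕ :=
  if ∃ i ∈ S, 0 < μ i then #S - 1 else #S

section Balanced

variable {ι : Type*} {μ : ι → ℝ} {S : Finset ι}

theorem isBalanced_empty : IsBalanced μ ∅ := by simp [IsBalanced]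

theorem isBalanced_of_mem {i j : ι} (hi : i ∈ S) (hi0 : 0 < μ i) (hj : j ∈ S) (hj0 : μ j < 0) :
    IsBalanced μ S := ⟨fun _ => ⟨j, hj, hj0⟩, fun _ => ⟨i, hi, hi0⟩⟩

theorem balancedRank_of_mem {i : ι} (hi : i ∈ S) (hi0 : 0 < μ i) :
    balancedRank μ S = #S - 1 := if_pos ⟨i, hi, hi0⟩

theorem balancedRank_of_not (h : ¬ ∃ i ∈ S, 0 < μ i) : balancedRank μ S = #S := if_neg h

theorem isBalanced_of_zero (h : ∀ i ∈ S, μ i = 0) : IsBalanced μ S := by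
  constructor <;> rintro ⟨i, hi, h0⟩ <;> simp [h i hi] at h0

theorem balancedRank_of_zero (h : ∀ i ∈ S, μ i = 0) : balancedRank μ S = #S := by
  apply balancedRank_of_not
  rintro ⟨i, hi, h0⟩
  simp [h i hi] at h0

theorem IsBalanced.eq_zero (hS : IsBalanced μ S) (h : ¬ ∃ i ∈ S, 0 < μ i) :
    ∀ i ∈ S, μ i = 0 := by
  have h' : ¬ ∃ i ∈ S, μ i < 0 := fun hn => h (hS.2 hn)
  push Not at h h'
  exact fun i hi => le_antisymm (h i hi) (h' i hi)

theorem one_le_balancedRank (hS : IsBalanced μ S) (hne : S.Nonempty) : 1 ≤ balancedRank μ S := by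
  by_cases h : ∃ i ∈ S, 0 < μ i
  · obtain ⟨j, hj, hj0⟩ := hS.1 h
    obtain ⟨i, hi, hi0⟩ := h
    rw [balancedRank_of_mem hi hi0]
    have : 1 < #S := one_lt_card.2 ⟨i, hi, j, hj, by rintro rfl; linarith⟩
    omega
  · rw [balancedRank_of_not h]
    exact hne.card_pos

/-- Ranks go down in steps of one. A set with one positive, one negative and otherwise zero
coefficients loses the first two together, which costs two elements but only one in rank. -/
theorem exists_ssubset_balancedRank (hS : IsBalanced μ S) (hne : S.Nonempty) :
    ∃ S' ⊂ S, IsBalanced μ S' ∧ balancedRank μ S' + 1 = balancedRank μ S := by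
  classical
  by_cases h : ∃ i ∈ S, 0 < μ i
  · obtain ⟨j, hj, hj0⟩ := hS.1 h
    obtain ⟨i, hi, hi0⟩ := h
    have hij : i ≠ j := by rintro rfl; linarith
    rw [balancedRank_of_mem hi hi0]
    by_cases hk : ∃ k ∈ S, k ≠ i ∧ k ≠ j ∧ μ k ≠ 0
    · obtain ⟨k, hk, hki, hkj, -⟩ := hk
      have hi' : i ∈ S.erase k := mem_erase.2 ⟨hki.symm, hi⟩
      have hj' : j ∈ S.erase k := mem_erase.2 ⟨hkj.symm, hj⟩
      refine ⟨S.erase k, erase_ssubset hk, isBalanced_of_mem hi' hi0 hj' hj0, ?_⟩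
      rw [balancedRank_of_mem hi' hi0]
      have : 1 < #(S.erase k) := one_lt_card.2 ⟨i, hi', j, hj', hij⟩
      have := card_erase_add_one hk
      omega
    · push Not at hk
      have hz : ∀ k ∈ (S.erase i).erase j, μ k = 0 := by
        intro k hk'
        simp only [mem_erase] at hk'
        exact hk k hk'.2.2 hk'.2.1 hk'.1
      refine ⟨(S.erase i).erase j, (erase_subset _ _).trans_ssubset (erase_ssubset hi),
        isBalanced_of_zero hz, ?_⟩
      rw [balancedRank_of_zero hz]
      have := card_erase_add_one hi
      have := card_erase_add_one (mem_erase.2 ⟨hij.symm, hj⟩)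
      omega
  · have hz := hS.eq_zero h
    obtain ⟨k, hk⟩ := hne
    have hz' : ∀ i ∈ S.erase k, μ i = 0 := fun i hi => hz i (mem_of_mem_erase hi)
    refine ⟨S.erase k, erase_ssubset hk, isBalanced_of_zero hz', ?_⟩
    rw [balancedRank_of_zero hz, balancedRank_of_zero hz', card_erase_add_one hk]

/-- Ranks go up in steps of one. To a set of zero coefficients a positive and a negative one are
added together, which adds two elements but only one in rank. -/
theorem exists_ssuperset_balancedRank [Fintype ι] (hpos : ∃ i, 0 < μ i) (hneg : ∃ i, μ i < 0)
    (hS : IsBalanced μ S) (hne : S ≠ univ) :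
    ∃ S', S ⊂ S' ∧ IsBalanced μ S' ∧ balancedRank μ S' = balancedRank μ S + 1 := by
  classical
  by_cases h : ∃ i ∈ S, 0 < μ i
  · obtain ⟨j, hj, hj0⟩ := hS.1 h
    obtain ⟨i, hi, hi0⟩ := h
    obtain ⟨k, hk⟩ : ∃ k, k ∉ S := by
      by_contra! hk
      exact hne (eq_univ_of_forall hk)
    refine ⟨insert k S, ssubset_insert hk,
      isBalanced_of_mem (mem_insert_of_mem hi) hi0 (mem_insert_of_mem hj) hj0, ?_⟩
    rw [balancedRank_of_mem hi hi0, balancedRank_of_mem (mem_insert_of_mem hi) hi0,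
      card_insert_of_notMem hk]
    have : 0 < #S := card_pos.2 ⟨i, hi⟩
    omega
  · have hz := hS.eq_zero h
    obtain ⟨i, hi0⟩ := hpos
    obtain ⟨j, hj0⟩ := hneg
    have hi : i ∉ S := fun hi => hi0.ne' (hz i hi)
    have hj : j ∉ S := fun hj => hj0.ne (hz j hj)
    have hij : i ∉ insert j S := by
      rw [mem_insert, not_or]
      exact ⟨by rintro rfl; linarith, hi⟩
    refine ⟨insert i (insert j S), (ssubset_insert hj).trans (ssubset_insert hij),
      isBalanced_of_mem (mem_insert_self _ _) hi0 (mem_insert_of_mem (mem_insert_self _ _)) hj0, ?_⟩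
    rw [balancedRank_of_mem (mem_insert_self _ _) hi0, balancedRank_of_zero hz,
      card_insert_of_notMem hij, card_insert_of_notMem hj]
    omega

/-- The balanced sets of a given positive rank, counted by inclusion and exclusion. -/
theorem ncard_balancedRank_eq [Fintype ι] (k d p q : ℕ) (hd : Fintype.card ι = d + 2)
    (hp : Nat.card {i // 0 < μ i} = p) (hq : Nat.card {i // μ i < 0} = q) :
    (Set.ncard {S : Finset ι | IsBalanced μ S ∧ balancedRank μ S = k + 1} : ℤ)
      = galeFaceCount k d p q := by
  classical
  let A : Finset ι := univ.filter fun i => ¬ 0 < μ i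
  let B : Finset ι := univ.filter fun i => ¬ μ i < 0
  have hpA : #A + p = d + 2 := by
    rw [← hp, ← hd, Nat.card_eq_fintype_card, Fintype.card_subtype, add_comm]
    exact card_filter_add_card_filter_not _
  have hqB : #B + q = d + 2 := by
    rw [← hq, ← hd, Nat.card_eq_fintype_card, Fintype.card_subtype, add_comm]
    exact card_filter_add_card_filter_not _
  have hAB : #(A ∩ B) + (p + q) = d + 2 := by
    have h1 : A ∪ B = univ := by
      ext i
      simp only [A, B, mem_union, mem_filter, mem_univ, true_and, iff_true]
      by_contra! h
      linarith [h.1, h.2]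
    have := card_union_add_card_inter A B
    rw [h1, card_univ, hd] at this
    omega
  have hset : {S : Finset ι | IsBalanced μ S ∧ balancedRank μ S = k + 1}
      = ((powersetCard (k + 2) univ \ (powersetCard (k + 2) A ∪ powersetCard (k + 2) B))
        ∪ powersetCard (k + 1) (A ∩ B) : Finset (Finset ι)) := by
    ext S
    simp only [Set.mem_ofPred_eq, coe_union, coe_sdiff, Set.mem_union, Set.mem_sdiff, mem_coe,
      mem_powersetCard, subset_univ, true_and, subset_inter_iff]
    have hA : S ⊆ A ↔ ¬ ∃ i ∈ S, 0 < μ i := by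
      simp [A, subset_iff]
    have hB : S ⊆ B ↔ ¬ ∃ i ∈ S, μ i < 0 := by
      simp [B, subset_iff]
    rw [hA, hB]
    constructor
    · rintro ⟨hS, hr⟩
      by_cases h : ∃ i ∈ S, 0 < μ i
      · obtain ⟨i, hi, hi0⟩ := id h
        rw [balancedRank_of_mem hi hi0] at hr
        have := hS.1 h
        exact Or.inl ⟨by omega, by rintro (⟨h', -⟩ | ⟨h', -⟩) <;> exact h' ‹_›⟩
      · rw [balancedRank_of_not h] at hr
        have : ¬ ∃ i ∈ S, μ i < 0 := fun h' => h (hS.2 h')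
        exact Or.inr ⟨⟨h, this⟩, hr⟩
    · rintro (⟨hc, h⟩ | ⟨⟨h, h'⟩, hr⟩)
      · have h1 : ∃ i ∈ S, 0 < μ i := by tauto
        have h2 : ∃ i ∈ S, μ i < 0 := by tauto
        obtain ⟨i, hi, hi0⟩ := id h1
        refine ⟨⟨fun _ => h2, fun _ => h1⟩, ?_⟩
        rw [balancedRank_of_mem hi hi0]
        omega
      · exact ⟨⟨fun a => absurd a h, fun a => absurd a h'⟩, by rw [balancedRank_of_not h, hr]⟩
  have hdisj : Disjoint
      (powersetCard (k + 2) univ \ (powersetCard (k + 2) A ∪ powersetCard (k + 2) B))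
      (powersetCard (k + 1) (A ∩ B)) := by
    rw [disjoint_left]
    intro S h1 h2
    have := (mem_powersetCard.1 (mem_sdiff.1 h1).1).2
    have := (mem_powersetCard.1 h2).2
    omega
  rw [hset, Set.ncard_coe_finset, card_union_of_disjoint hdisj, card_powersetCard]
  have hsub : powersetCard (k + 2) A ∪ powersetCard (k + 2) B ⊆ powersetCard (k + 2) univ :=
    union_subset (powersetCard_mono (subset_univ _)) (powersetCard_mono (subset_univ _))
  have h1 := card_sdiff_add_card_eq_card hsub
  have h2 := card_union_add_card_inter (powersetCard (k + 2) A) (powersetCard (k + 2) B)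
  have h3 : powersetCard (k + 2) A ∩ powersetCard (k + 2) B = powersetCard (k + 2) (A ∩ B) := by
    ext S
    simp only [mem_inter, mem_powersetCard, subset_inter_iff]
    tauto
  simp only [h3, card_powersetCard, card_univ, hd] at h1 h2
  have h4 : (d + 3 - p - q).choose (k + 2)
      = (#(A ∩ B)).choose (k + 1) + (#(A ∩ B)).choose (k + 2) := by
    rw [← Nat.choose_succ_succ]
    congr 1
    omega
  unfold galeFaceCount
  rw [show d + 2 - p = #A by omega, show d + 2 - q = #B by omega, h4]
  zify at h1 h2
  push_cast
  linarith

end Balanced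

/-! ### Dimensions of faces from the face lattice -/

section ExposedFaces

variable {E : Type*} [NormedAddCommGroup E] [NormedSpace ℝ E]

/-- A face properly contained in a set of points of the polytope has smaller dimension: it lies in
a hyperplane that does not contain the larger set. -/
theorem affDim_lt_of_isExposed [FiniteDimensional ℝ E] {P F G : Set E} (hF : IsExposed ℝ P F)
    (hne : F.Nonempty) (hFG : F ⊂ G) (hG : G ⊆ P) : affDim F < affDim G := by
  obtain ⟨l, rfl⟩ := hF hne
  obtain ⟨x, hx⟩ := hne
  obtain ⟨g, hg, hgF⟩ := Set.exists_of_ssubset hFG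
  have hker : vectorSpan ℝ {x ∈ P | ∀ y ∈ P, l y ≤ l x} ≤ LinearMap.ker l.toLinearMap := by
    rw [vectorSpan_def, Submodule.span_le]
    rintro _ ⟨u, hu, v, hv, rfl⟩
    have : l u = l v := le_antisymm (hv.2 u hu.1) (hu.2 v hv.1)
    simp [this]
  refine Submodule.finrank_lt_finrank_of_lt (lt_of_le_of_ne (vectorSpan_mono ℝ hFG.1) ?_)
  intro h
  have hm : g -ᵥ x ∈ vectorSpan ℝ {x ∈ P | ∀ y ∈ P, l y ≤ l x} := by
    rw [h]
    exact vsub_mem_vectorSpan ℝ hg (hFG.1 hx)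
  have h0 : l g = l x := by
    have := hker hm
    simpa [sub_eq_zero] using this
  exact hgF ⟨hG hg, fun y hy => h0 ▸ hx.2 y hy⟩

variable {ι : Type*} {μ : ι → ℝ} {P : Set E}

theorem orderIso_nonempty_iff
    (e : {F : Set E // IsExposed ℝ P F} ≃o {S : Finset ι // IsBalanced μ S})
    (F : {F : Set E // IsExposed ℝ P F}) : F.1.Nonempty ↔ (e F).1.Nonempty := by
  have h0 : e ⟨∅, isExposed_empty⟩ = ⟨∅, isBalanced_empty⟩ := by
    apply le_antisymm
    · rw [← OrderIso.le_symm_apply]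
      exact Set.empty_subset _
    · exact Finset.empty_subset _
  rw [Set.nonempty_iff_ne_empty, Finset.nonempty_iff_ne_empty, not_iff_not]
  constructor
  · intro h
    rw [show F = ⟨∅, isExposed_empty⟩ from Subtype.ext h, h0]
  · intro h
    have : e F = e ⟨∅, isExposed_empty⟩ := h0 ▸ Subtype.ext h
    rw [e.injective this]

/-- If the face lattice of a polytope of the right dimension is isomorphic to the poset of balanced
sets, then the dimensions of its faces are given by the rank of the balanced sets: dimensions grow
strictly along the saturated chains of balanced sets, and the ends of these chains leave no room
for anything but steps of one. -/
theorem affDim_add_one_eq_balancedRank [Fintype ι] [FiniteDimensional ℝ E]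
    (hpos : ∃ i, 0 < μ i) (hneg : ∃ i, μ i < 0)
    (e : {F : Set E // IsExposed ℝ P F} ≃o {S : Finset ι // IsBalanced μ S})
    (hP : affDim P + 2 = Fintype.card ι) (F : {F : Set E // IsExposed ℝ P F})
    (hF : F.1.Nonempty) : affDim F.1 + 1 = balancedRank μ (e F).1 := by
  have hlt : ∀ S T : {S : Finset ι // IsBalanced μ S}, S.1.Nonempty → S.1 ⊂ T.1 →
      affDim (e.symm S).1 < affDim (e.symm T).1 := by
    intro S T hS hST
    have h1 : e.symm S < e.symm T := e.symm.lt_iff_lt.2 hST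
    refine affDim_lt_of_isExposed (e.symm S).2 ?_ h1 (e.symm T).2.subset
    rw [orderIso_nonempty_iff e, e.apply_symm_apply]
    exact hS
  -- going down from `S` to a vertex, the dimension drops at least once per step
  have lower : ∀ n, ∀ S : {S : Finset ι // IsBalanced μ S}, balancedRank μ S.1 = n + 1 →
      n ≤ affDim (e.symm S).1 := by
    intro n
    induction n with
    | zero => exact fun _ _ => Nat.zero_le _
    | succ n ih =>
      intro S hS
      have hne : S.1.Nonempty := by
        by_contra h
        rw [Finset.not_nonempty_iff_eq_empty] at h
        simp [h, balancedRank] at hS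
      obtain ⟨T, hTS, hT, hr⟩ := exists_ssubset_balancedRank S.2 hne
      have hTne : T.Nonempty := by
        by_contra h
        rw [Finset.not_nonempty_iff_eq_empty] at h
        subst h
        have : balancedRank μ ∅ = 0 := by simp [balancedRank]
        omega
      have h1 := ih ⟨T, hT⟩ (by simp only; omega)
      have h2 := hlt ⟨T, hT⟩ S hTne hTS
      omega
  have huniv : IsBalanced μ (univ : Finset ι) := by
    obtain ⟨i, hi⟩ := hpos
    obtain ⟨j, hj⟩ := hneg
    exact isBalanced_of_mem (mem_univ i) hi (mem_univ j) hj
  have htop : (e.symm ⟨univ, huniv⟩).1 = P := by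
    refine (e.symm ⟨univ, huniv⟩).2.subset.antisymm ?_
    have : (⟨P, IsExposed.refl P⟩ : {F : Set E // IsExposed ℝ P F}) ≤ e.symm ⟨univ, huniv⟩ := by
      rw [OrderIso.le_symm_apply]
      exact Finset.subset_univ _
    exact this
  -- going up from `S` to the whole polytope, the dimension grows at least once per step
  have upper : ∀ n, ∀ S : {S : Finset ι // IsBalanced μ S}, S.1.Nonempty →
      Fintype.card ι - #S.1 = n → affDim (e.symm S).1 + 1 ≤ balancedRank μ S.1 := by
    intro n
    induction n using Nat.strong_induction_on with
    | _ n ih =>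
      intro S hne hn
      by_cases hS : S.1 = univ
      · obtain rfl : S = ⟨univ, huniv⟩ := Subtype.ext hS
        obtain ⟨i, hi⟩ := hpos
        rw [htop, balancedRank_of_mem (mem_univ i) hi, card_univ, ← hP]
        omega
      · obtain ⟨T, hST, hT, hr⟩ := exists_ssuperset_balancedRank hpos hneg S.2 hS
        have hc := card_lt_card hST
        have hc' := card_le_univ T
        have h1 := ih (Fintype.card ι - #T) (by omega) ⟨T, hT⟩ (hne.mono hST.1) rfl
        have h2 := hlt S ⟨T, hT⟩ hne hST
        simp only at h1
        omega
  have hne := (orderIso_nonempty_iff e F).1 hF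
  have h1 := upper _ (e F) hne rfl
  have h2 := lower (balancedRank μ (e F).1 - 1) (e F)
    (by have := one_le_balancedRank (e F).2 hne; omega)
  rw [e.symm_apply_apply] at h1 h2
  omega

/-- The face numbers of a polytope whose face lattice is the poset of balanced sets. -/
theorem faceCount_eq_galeFaceCount [Fintype ι] {n d p q : ℕ} {P : Set (EuclideanSpace ℝ (Fin n))}
    (e : FaceLattice P ≃o {S : Finset ι // IsBalanced μ S})
    (hd : Fintype.card ι = d + 2) (hP : affDim P = d)
    (hp : Nat.card {i // 0 < μ i} = p) (hq : Nat.card {i // μ i < 0} = q)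
    (hp0 : 0 < p) (hq0 : 0 < q) (k : ℕ) :
    (faceCount k P : ℤ) = galeFaceCount k d p q := by
  have hpos : ∃ i, 0 < μ i := by
    subst hp
    obtain ⟨⟨i, hi⟩⟩ := (Nat.card_pos_iff.1 hp0).1
    exact ⟨i, hi⟩
  have hneg : ∃ i, μ i < 0 := by
    subst hq
    obtain ⟨⟨i, hi⟩⟩ := (Nat.card_pos_iff.1 hq0).1
    exact ⟨i, hi⟩
  rw [← ncard_balancedRank_eq k d p q hd hp hq, faceCount]
  congr 1
  refine Set.ncard_congr (fun F hF => (e ⟨F, hF.2.1⟩).1) ?_ ?_ ?_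
  · rintro F ⟨hne, hF, hk⟩
    refine ⟨(e ⟨F, hF⟩).2, ?_⟩
    rw [← affDim_add_one_eq_balancedRank hpos hneg e (by rw [hP, hd]) ⟨F, hF⟩ hne, hk]
  · rintro F G hF hG h
    exact congrArg Subtype.val (e.injective (Subtype.ext h))
  · rintro S ⟨hS, hk⟩
    have hS' : e ⟨(e.symm ⟨S, hS⟩).1, (e.symm ⟨S, hS⟩).2⟩ = ⟨S, hS⟩ := e.apply_symm_apply _
    have hne : (e.symm ⟨S, hS⟩).1.Nonempty := by
      rw [orderIso_nonempty_iff e, e.apply_symm_apply, Finset.nonempty_iff_ne_empty]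
      rintro rfl
      simp [balancedRank] at hk
    refine ⟨(e.symm ⟨S, hS⟩).1, ⟨hne, (e.symm ⟨S, hS⟩).2, ?_⟩, by rw [hS']⟩
    have := affDim_add_one_eq_balancedRank hpos hneg e (by rw [hP, hd]) (e.symm ⟨S, hS⟩) hne
    rw [e.apply_symm_apply, hk] at this
    omega

end ExposedFaces

/-! ### Faces of a hyperplane section of a simplex -/

section SimplexSection

variable {ι : Type*} [Fintype ι]

/-- The section of the standard simplex by the hyperplane through the origin with normal `μ`. -/
def simplexSection (μ : ι → ℝ) : Set (ι → ℝ) :=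
  {z | (∀ i, 0 ≤ z i) ∧ ∑ i, z i = 1 ∧ ∑ i, μ i * z i = 0}

variable {μ : ι → ℝ}

theorem convex_simplexSection : Convex ℝ (simplexSection μ) := by
  rintro z ⟨hz, hz1, hz0⟩ w ⟨hw, hw1, hw0⟩ a b ha hb hab
  refine ⟨fun i => ?_, ?_, ?_⟩
  · have := mul_nonneg ha (hz i)
    have := mul_nonneg hb (hw i)
    simp only [Pi.add_apply, Pi.smul_apply, smul_eq_mul]
    linarith
  · simp only [Pi.add_apply, Pi.smul_apply, smul_eq_mul, sum_add_distrib, ← mul_sum, hz1, hw1]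
    linarith
  · simp only [Pi.add_apply, Pi.smul_apply, smul_eq_mul, mul_add, sum_add_distrib,
      mul_left_comm (μ _), ← mul_sum, hz0, hw0]
    simp

theorem isCompact_simplexSection : IsCompact (simplexSection μ) := by
  refine (isCompact_stdSimplex ℝ ι).of_isClosed_subset ?_ fun z hz => ⟨hz.1, hz.2.1⟩
  refine IsClosed.inter (isClosed_Ici (a := (0 : ι → ℝ))) (IsClosed.inter ?_ ?_)
  · exact isClosed_eq (by fun_prop) continuous_const
  · exact isClosed_eq (by fun_prop) continuous_const

/-- The support of a vector. -/
noncomputable def finSupp (z : ι → ℝ) : Finset ι := by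
  classical exact univ.filter fun i => z i ≠ 0

@[simp] theorem mem_finSupp {z : ι → ℝ} {i : ι} : i ∈ finSupp z ↔ z i ≠ 0 := by
  simp [finSupp]

theorem isBalanced_finSupp {z : ι → ℝ} (hz : z ∈ simplexSection μ) :
    IsBalanced μ (finSupp z) := by
  obtain ⟨h0, -, hμ⟩ := hz
  have hp : ∀ i ∈ finSupp z, 0 < z i := fun i hi =>
    lt_of_le_of_ne (h0 i) (mem_finSupp.1 hi).symm
  constructor
  · rintro ⟨i, hi, hi0⟩
    by_contra! h
    have : 0 < ∑ i, μ i * z i := by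
      refine sum_pos' (fun j _ => ?_) ⟨i, mem_univ _, mul_pos hi0 (hp i hi)⟩
      by_cases hj : j ∈ finSupp z
      · exact mul_nonneg (h j hj) (h0 j)
      · simp [not_not.1 (mt mem_finSupp.2 hj)]
    exact this.ne' hμ
  · rintro ⟨i, hi, hi0⟩
    by_contra! h
    have : 0 < ∑ i, -(μ i * z i) := by
      refine sum_pos' (fun j _ => ?_) ⟨i, mem_univ _,
        neg_pos.2 (mul_neg_of_neg_of_pos hi0 (hp i hi))⟩
      by_cases hj : j ∈ finSupp z
      · have := mul_nonneg (neg_nonneg.2 (h j hj)) (h0 j)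
        linarith
      · simp [not_not.1 (mt mem_finSupp.2 hj)]
    rw [sum_neg_distrib, hμ] at this
    simp at this

/-- Every nonempty balanced set is the support of a point: balance the positive against the negative
coefficients. -/
theorem exists_finSupp_eq {S : Finset ι} (hS : IsBalanced μ S) (hne : S.Nonempty) :
    ∃ z ∈ simplexSection μ, finSupp z = S := by
  classical
  suffices h : ∃ w : ι → ℝ, (∀ i, 0 ≤ w i) ∧ finSupp w = S ∧ ∑ i, μ i * w i = 0 by
    obtain ⟨w, h0, hw, hμ⟩ := h
    have hpos : 0 < ∑ i, w i := by
      obtain ⟨i, hi⟩ := hne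
      refine sum_pos' (fun i _ => h0 i) ⟨i, mem_univ _, lt_of_le_of_ne (h0 i) ?_⟩
      exact (mem_finSupp.1 (hw ▸ hi)).symm
    refine ⟨fun i => w i / ∑ i, w i, ⟨fun i => div_nonneg (h0 i) hpos.le, ?_, ?_⟩, ?_⟩
    · rw [← sum_div, div_self hpos.ne']
    · simp only [← mul_div_assoc]
      rw [← sum_div, hμ, zero_div]
    · rw [← hw]
      ext i
      simp [hpos.ne']
  by_cases h : ∃ i ∈ S, 0 < μ i
  · have h' := hS.1 h
    set A := ∑ i ∈ S with 0 < μ i, μ i with hA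
    set B := ∑ i ∈ S with μ i < 0, -μ i with hB
    have hA0 : 0 < A := by
      obtain ⟨i, hi, hi0⟩ := h
      exact sum_pos (fun j hj => (mem_filter.1 hj).2) ⟨i, mem_filter.2 ⟨hi, hi0⟩⟩
    have hB0 : 0 < B := by
      obtain ⟨i, hi, hi0⟩ := h'
      exact sum_pos (fun j hj => neg_pos.2 (mem_filter.1 hj).2) ⟨i, mem_filter.2 ⟨hi, hi0⟩⟩
    refine ⟨fun i => if i ∈ S then if 0 < μ i then B else if μ i < 0 then A else 1 else 0,
      fun i => ?_, ?_, ?_⟩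
    · simp only
      split_ifs <;> positivity
    · ext i
      rw [mem_finSupp]
      by_cases hi : i ∈ S
      · simp only [hi, if_true, iff_true]
        split_ifs <;> positivity
      · simp [hi]
    · have : ∀ i, μ i * (if i ∈ S then if 0 < μ i then B else if μ i < 0 then A else 1 else 0)
          = (if i ∈ S then if 0 < μ i then μ i * B else 0 else 0)
            - if i ∈ S then if μ i < 0 then -μ i * A else 0 else 0 := by
        intro i
        rcases lt_trichotomy (μ i) 0 with h | h | h
        · by_cases hi : i ∈ S <;> simp [hi, h, h.not_gt]
        · simp [h]
        · by_cases hi : i ∈ S <;> simp [hi, h, h.not_gt]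
      simp only [this]
      rw [sum_sub_distrib, sum_ite_mem, sum_ite_mem, univ_inter, ← sum_filter, ← sum_filter,
        ← sum_mul, ← sum_mul, ← hA, ← hB]
      ring
  · have hz := hS.eq_zero h
    refine ⟨fun i => if i ∈ S then 1 else 0, fun i => ?_, ?_, ?_⟩
    · simp only
      split_ifs <;> norm_num
    · ext i
      simp
    · refine sum_eq_zero fun i _ => ?_
      by_cases hi : i ∈ S <;> simp [hi, hz]

/-- A point of the section whose support contains that of `w` can be moved a little away
from `w`. -/
theorem exists_extend_mem_simplexSection {z w : ι → ℝ} (hz : z ∈ simplexSection μ)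
    (hw : w ∈ simplexSection μ) (h : finSupp w ⊆ finSupp z) :
    ∃ ε > (0 : ℝ), z - ε • (w - z) ∈ simplexSection μ := by
  have hev : ∀ i, ∃ ε > (0 : ℝ), ∀ δ, 0 < δ → δ ≤ ε → 0 ≤ z i - δ * (w i - z i) := by
    intro i
    by_cases hi : z i = 0
    · have : w i = 0 := by
        by_contra h'
        exact mem_finSupp.1 (h (mem_finSupp.2 h')) hi
      exact ⟨1, one_pos, by simp [hi, this]⟩
    · have hzi : 0 < z i := lt_of_le_of_ne (hz.1 i) (Ne.symm hi)
      have hwi := hw.1 i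
      refine ⟨z i / (w i + 1), by positivity, fun δ hδ hle => ?_⟩
      rw [le_div_iff₀ (by positivity)] at hle
      nlinarith
  choose f hf hf' using hev
  have hne : (univ : Finset ι).Nonempty := by
    by_contra h'
    have := hz.2.1
    rw [not_nonempty_iff_eq_empty.1 h'] at this
    simp at this
  refine ⟨univ.inf' hne f, (lt_inf'_iff hne).2 fun i _ => hf i, fun i => ?_, ?_, ?_⟩
  · exact hf' i _ ((lt_inf'_iff hne).2 fun i _ => hf i) (inf'_le _ (mem_univ i))
  · simp only [Pi.sub_apply, Pi.smul_apply, smul_eq_mul, sum_sub_distrib, ← mul_sum, hz.2.1,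
      hw.2.1]
    simp
  · simp only [Pi.sub_apply, Pi.smul_apply, smul_eq_mul, mul_sub, sum_sub_distrib,
      mul_left_comm (μ _), ← mul_sum, hz.2.2, hw.2.2]
    simp

/-- The face of the section on which the coordinates outside `S` vanish. -/
def sectionFace (μ : ι → ℝ) (S : Finset ι) : Set (ι → ℝ) :=
  {z ∈ simplexSection μ | finSupp z ⊆ S}

theorem isExposed_sectionFace (S : Finset ι) :
    IsExposed ℝ (simplexSection μ) (sectionFace μ S) := by
  classical
  rintro ⟨z₀, hz₀, hS₀⟩
  refine ⟨-∑ i ∈ Sᶜ, ContinuousLinearMap.proj (R := ℝ) (φ := fun _ : ι => ℝ) i, ?_⟩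
  have hl : ∀ z : ι → ℝ, (-∑ i ∈ Sᶜ, ContinuousLinearMap.proj (R := ℝ) (φ := fun _ : ι => ℝ) i :
      StrongDual ℝ (ι → ℝ)) z = -∑ i ∈ Sᶜ, z i := by
    intro z
    simp
  have hle : ∀ z ∈ simplexSection μ, -∑ i ∈ Sᶜ, z i ≤ 0 := fun z hz =>
    neg_nonpos.2 (sum_nonneg fun i _ => hz.1 i)
  have heq : ∀ z ∈ simplexSection μ, finSupp z ⊆ S ↔ -∑ i ∈ Sᶜ, z i = 0 := by
    intro z hz
    rw [neg_eq_zero, sum_eq_zero_iff_of_nonneg fun i _ => hz.1 i]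
    constructor
    · intro h i hi
      by_contra hi0
      exact mem_compl.1 hi (h (mem_finSupp.2 hi0))
    · intro h i hi
      by_contra hi0
      exact mem_finSupp.1 hi (h i (mem_compl.2 hi0))
  ext z
  simp only [sectionFace, Set.mem_ofPred_eq, hl]
  refine and_congr_right fun hz => ?_
  rw [heq z hz]
  constructor
  · intro h y hy
    rw [h]
    exact hle y hy
  · intro h
    have := h z₀ hz₀
    rw [(heq z₀ hz₀).1 hS₀] at this
    exact le_antisymm (hle z hz) this

theorem sectionFace_subset_iff {S T : Finset ι} (hS : IsBalanced μ S) :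
    sectionFace μ S ⊆ sectionFace μ T ↔ S ⊆ T := by
  refine ⟨fun h => ?_, fun h z hz => ⟨hz.1, hz.2.trans h⟩⟩
  rcases S.eq_empty_or_nonempty with rfl | hne
  · exact empty_subset _
  · obtain ⟨z, hz, rfl⟩ := exists_finSupp_eq hS hne
    exact (h ⟨hz, subset_rfl⟩).2

theorem sectionFace_empty : sectionFace μ ∅ = ∅ := by
  rw [Set.eq_empty_iff_forall_notMem]
  rintro z ⟨hz, h⟩
  have h0 : ∀ i, z i = 0 := fun i => by
    by_contra hi
    exact notMem_empty i (h (mem_finSupp.2 hi))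
  have := hz.2.1
  simp [h0] at this

/-- Every exposed face of the section is cut out by a balanced set, namely by the support of a point
of the face with maximal support. -/
theorem exists_eq_sectionFace {F : Set (ι → ℝ)} (hF : IsExposed ℝ (simplexSection μ) F) :
    ∃ S, IsBalanced μ S ∧ sectionFace μ S = F := by
  rcases F.eq_empty_or_nonempty with rfl | hne
  · exact ⟨∅, isBalanced_empty, sectionFace_empty⟩
  obtain ⟨l, rfl⟩ := hF hne
  have hconv := hF.convex convex_simplexSection
  obtain ⟨z, hz, hmax⟩ : ∃ z ∈ {x ∈ simplexSection μ | ∀ y ∈ simplexSection μ, l y ≤ l x},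
      ∀ w ∈ {x ∈ simplexSection μ | ∀ y ∈ simplexSection μ, l y ≤ l x},
        #(finSupp w) ≤ #(finSupp z) := by
    obtain ⟨_, ⟨z, hz, rfl⟩, hmax⟩ := Set.exists_max_image _ card
      (Set.toFinite (finSupp '' {x ∈ simplexSection μ | ∀ y ∈ simplexSection μ, l y ≤ l x}))
      (hne.image _)
    exact ⟨z, hz, fun w hw => hmax _ (Set.mem_image_of_mem _ hw)⟩
  refine ⟨finSupp z, isBalanced_finSupp hz.1, ?_⟩
  ext w
  constructor
  · rintro ⟨hw, hws⟩
    obtain ⟨ε, hε, hmem⟩ := exists_extend_mem_simplexSection hz.1 hw hws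
    have h1 := hz.2 _ hmem
    rw [map_sub, map_smul, map_sub, smul_eq_mul] at h1
    have h2 : l z ≤ l w := by
      by_contra! h
      nlinarith
    exact ⟨hw, fun y hy => (hz.2 y hy).trans h2⟩
  · intro hw
    refine ⟨hw.1, ?_⟩
    have hmid := hconv hz hw (a := 1 / 2) (b := 1 / 2) (by norm_num) (by norm_num) (by norm_num)
    have hsupp : ∀ i, i ∈ finSupp ((1 / 2 : ℝ) • z + (1 / 2 : ℝ) • w)
        ↔ i ∈ finSupp z ∨ i ∈ finSupp w := by
      intro i
      have h1 := hz.1.1 i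
      have h2 := hw.1.1 i
      simp only [mem_finSupp, Pi.add_apply, Pi.smul_apply, smul_eq_mul]
      rw [← not_and_or, not_iff_not]
      constructor
      · intro h
        constructor <;> linarith
      · rintro ⟨h, h'⟩
        rw [h, h']
        norm_num
    have heq := eq_of_subset_of_card_le (fun i hi => (hsupp i).2 (Or.inl hi)) (hmax _ hmid)
    intro i hi
    rw [heq]
    exact (hsupp i).2 (Or.inr hi)

/-- The face lattice of the section is the poset of balanced sets. -/
theorem nonempty_orderIso_simplexSection (μ : ι → ℝ) :
    Nonempty ({F : Set (ι → ℝ) // IsExposed ℝ (simplexSection μ) F}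
      ≃o {S : Finset ι // IsBalanced μ S}) := by
  let f : {S : Finset ι // IsBalanced μ S} ↪o
      {F : Set (ι → ℝ) // IsExposed ℝ (simplexSection μ) F} :=
    OrderEmbedding.ofMapLEIff (fun S => ⟨sectionFace μ S.1, isExposed_sectionFace S.1⟩)
      fun S T => sectionFace_subset_iff S.2
  refine ⟨(RelIso.ofSurjective f ?_).symm⟩
  rintro ⟨F, hF⟩
  obtain ⟨S, hS, rfl⟩ := exists_eq_sectionFace hF
  exact ⟨⟨S, hS⟩, rfl⟩

/-- Extreme points of the section are determined by their supports. -/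
theorem finite_extremePoints_simplexSection : ((simplexSection μ).extremePoints ℝ).Finite := by
  refine Set.Finite.of_finite_image (f := finSupp) (Set.toFinite _) ?_
  intro z hz w hw h
  obtain ⟨ε, hε, hmem⟩ := exists_extend_mem_simplexSection hz.1 hw.1 h.ge
  have hseg : z ∈ openSegment ℝ (z - ε • (w - z)) w := by
    refine ⟨1 / (1 + ε), ε / (1 + ε), by positivity, by positivity, by field_simp, ?_⟩
    ext i
    simp only [Pi.add_apply, Pi.smul_apply, Pi.sub_apply, smul_eq_mul]
    field_simp
    ring
  have h0 : ε • (w - z) = 0 := sub_eq_self.1 (hz.2 hmem hw.1 hseg)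
  exact (sub_eq_zero.1 ((smul_eq_zero.1 h0).resolve_left hε.ne')).symm

end SimplexSection

/-! ### Affine isomorphisms -/

section AffineIsomorphism

/-- Two sets are affinely isomorphic if an affine map of the ambient spaces maps the first onto the
second and has an affine left inverse on the first. -/
def AffinelyIsomorphic {E F : Type*} [AddCommGroup E] [Module ℝ E] [AddCommGroup F] [Module ℝ F]
    (P : Set E) (Q : Set F) : Prop :=
  ∃ (f : E →ᵃ[ℝ] F) (g : F →ᵃ[ℝ] E), f '' P = Q ∧ ∀ x ∈ P, g (f x) = x

variable {E F : Type*} [NormedAddCommGroup E] [NormedSpace ℝ E]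
  [NormedAddCommGroup F] [NormedSpace ℝ F] {P : Set E} {Q : Set F}

theorem affDim_image_of_leftInvOn [FiniteDimensional ℝ E] [FiniteDimensional ℝ F]
    (f : E →ᵃ[ℝ] F) (g : F →ᵃ[ℝ] E) (h : ∀ x ∈ P, g (f x) = x) :
    affDim (f '' P) = affDim P := by
  have h' : g '' (f '' P) = P := by
    rw [Set.image_image]
    exact (Set.image_congr h).trans (Set.image_id' P)
  refine le_antisymm ?_ ?_
  · rw [affDim, ← AffineMap.map_vectorSpan]
    exact Submodule.finrank_map_le _ _
  · conv_lhs => rw [← h']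
    rw [affDim, ← AffineMap.map_vectorSpan]
    exact Submodule.finrank_map_le _ _

theorem isExposed_image_of_leftInvOn [FiniteDimensional ℝ F] (f : E →ᵃ[ℝ] F) (g : F →ᵃ[ℝ] E)
    (h : ∀ x ∈ P, g (f x) = x) {A : Set E} (hA : IsExposed ℝ P A) :
    IsExposed ℝ (f '' P) (f '' A) := by
  intro hne
  obtain ⟨l, rfl⟩ := hA hne.of_image
  refine ⟨LinearMap.toContinuousLinearMap (l.toLinearMap ∘ₗ g.linear), ?_⟩
  have key : ∀ x ∈ P, l (g.linear (f x)) = l x - l (g 0) := by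
    intro x hx
    rw [← map_sub, ← h x hx, h x hx]
    congr 1
    have := g.linearMap_vsub (f x) 0
    simpa [h x hx] using this
  ext y
  constructor
  · rintro ⟨x, hx, rfl⟩
    refine ⟨⟨x, hx.1, rfl⟩, ?_⟩
    rintro _ ⟨x', hx', rfl⟩
    have := hx.2 x' hx'
    simp only [LinearMap.coe_toContinuousLinearMap', LinearMap.comp_apply,
      ContinuousLinearMap.coe_coe, key x hx.1, key x' hx']
    linarith
  · rintro ⟨⟨x, hx, rfl⟩, hmax⟩
    refine ⟨x, ⟨hx, fun x' hx' => ?_⟩, rfl⟩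
    have := hmax _ ⟨x', hx', rfl⟩
    simp only [LinearMap.coe_toContinuousLinearMap', LinearMap.comp_apply,
      ContinuousLinearMap.coe_coe, key x hx, key x' hx'] at this
    linarith

theorem AffinelyIsomorphic.symm (h : AffinelyIsomorphic P Q) : AffinelyIsomorphic Q P := by
  obtain ⟨f, g, rfl, hg⟩ := h
  refine ⟨g, f, ?_, ?_⟩
  · rw [Set.image_image]
    exact (Set.image_congr hg).trans (Set.image_id' P)
  · rintro _ ⟨x, hx, rfl⟩
    rw [hg x hx]

/-- An affine isomorphism induces an isomorphism of face lattices which preserves dimensions. -/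
theorem AffinelyIsomorphic.exists_orderIso [FiniteDimensional ℝ E] [FiniteDimensional ℝ F]
    (h : AffinelyIsomorphic P Q) :
    ∃ e : {A : Set E // IsExposed ℝ P A} ≃o {B : Set F // IsExposed ℝ Q B},
      ∀ A, ((e A).1.Nonempty ↔ A.1.Nonempty) ∧ affDim (e A).1 = affDim A.1 := by
  obtain ⟨f, g, rfl, hg⟩ := h
  have hP : g '' (f '' P) = P := by
    rw [Set.image_image]
    exact (Set.image_congr hg).trans (Set.image_id' P)
  have hgf : ∀ A ⊆ P, g '' (f '' A) = A := fun A hA => by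
    rw [Set.image_image]
    exact (Set.image_congr fun x hx => hg x (hA hx)).trans (Set.image_id' A)
  have hf : ∀ y ∈ f '' P, f (g y) = y := by
    rintro _ ⟨x, hx, rfl⟩
    rw [hg x hx]
  have hfg : ∀ B ⊆ f '' P, f '' (g '' B) = B := fun B hB => by
    rw [Set.image_image]
    exact (Set.image_congr fun x hx => hf x (hB hx)).trans (Set.image_id' B)
  refine ⟨⟨⟨fun A => ⟨f '' A.1, isExposed_image_of_leftInvOn f g hg A.2⟩,
    fun B => ⟨g '' B.1, ?_⟩, ?_, ?_⟩, ?_⟩, ?_⟩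
  · have := isExposed_image_of_leftInvOn g f hf B.2
    rwa [hP] at this
  · exact fun A => Subtype.ext (hgf A.1 A.2.subset)
  · exact fun B => Subtype.ext (hfg B.1 B.2.subset)
  · intro A B
    constructor
    · intro h
      have : g '' (f '' A.1) ⊆ g '' (f '' B.1) := Set.image_mono h
      rw [hgf A.1 A.2.subset, hgf B.1 B.2.subset] at this
      exact this
    · exact fun h => Set.image_mono h
  · exact fun A => ⟨Set.image_nonempty,
      affDim_image_of_leftInvOn f g fun x hx => hg x (A.2.subset hx)⟩

theorem AffinelyIsomorphic.faceCount_eq {n m : ℕ} {P : Set (EuclideanSpace ℝ (Fin n))}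
    {Q : Set (EuclideanSpace ℝ (Fin m))} (h : AffinelyIsomorphic P Q) (k : ℕ) :
    faceCount k P = faceCount k Q := by
  obtain ⟨e, he⟩ := h.exists_orderIso
  refine Set.ncard_congr (fun A hA => (e ⟨A, hA.2.1⟩).1) ?_ ?_ ?_
  · rintro A ⟨hne, hA, hk⟩
    exact ⟨(he ⟨A, hA⟩).1.2 hne, (e ⟨A, hA⟩).2, (he ⟨A, hA⟩).2.trans hk⟩
  · rintro A B hA hB h
    exact congrArg Subtype.val (e.injective (Subtype.ext h))
  · rintro B ⟨hne, hB, hk⟩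
    have h1 := he (e.symm ⟨B, hB⟩)
    rw [e.apply_symm_apply] at h1
    exact ⟨(e.symm ⟨B, hB⟩).1, ⟨h1.1.1 hne, (e.symm ⟨B, hB⟩).2, h1.2.symm.trans hk⟩,
      congrArg Subtype.val (e.apply_symm_apply ⟨B, hB⟩)⟩

end AffineIsomorphism

/-! ### The slack map -/

section Slack

variable {ι : Type*} [Fintype ι]

/-- The vectors orthogonal to the all-ones vector and to a vector `μ` not proportional to it. -/
theorem finrank_ker_sum_prod {μ : ι → ℝ} (h : ∃ i j, μ i ≠ μ j) (φ : (ι → ℝ) →ₗ[ℝ] ℝ × ℝ)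
    (hφ : ∀ v, φ v = (∑ i, v i, ∑ i, μ i * v i)) :
    Module.finrank ℝ (LinearMap.ker φ) + 2 = Fintype.card ι := by
  classical
  obtain ⟨i, j, hij⟩ := h
  have hsurj : LinearMap.range φ = ⊤ := by
    rw [LinearMap.range_eq_top]
    rintro ⟨a, b⟩
    have hij' : μ i - μ j ≠ 0 := sub_ne_zero.2 hij
    refine ⟨Pi.single i ((b - μ j * a) / (μ i - μ j))
      + Pi.single j ((μ i * a - b) / (μ i - μ j)), ?_⟩
    rw [hφ]
    simp only [Pi.add_apply, mul_add, sum_add_distrib, sum_pi_single', mem_univ, if_true,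
      Prod.mk.injEq]
    simp only [Pi.single_apply, mul_ite, mul_zero, sum_ite_eq', mem_univ, if_true]
    constructor <;> field_simp <;> ring
  have := φ.finrank_range_add_finrank_ker
  rw [hsurj, finrank_top, Module.finrank_prod, Module.finrank_self,
    Module.finrank_fintype_fun_eq_card] at this
  omega

variable {E : Type*} [NormedAddCommGroup E] [InnerProductSpace ℝ E]

/-- The map to the weighted slacks `c i * (1 - ⟪y i, x⟫)` of the `finrank + 2` inequalities
`⟪y i, x⟫ ≤ 1` identifies their solution set with a section of a simplex. The weights make the
slacks sum to one, and the second linear relation between the `y i` gives the hyperplane. -/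
theorem affinelyIsomorphic_simplexSection (y : ι → E) (c l : ι → ℝ)
    (hcard : Fintype.card ι = Module.finrank ℝ E + 2)
    (hspan : Submodule.span ℝ (Set.range y) = ⊤)
    (hc : ∀ i, 0 < c i) (hc1 : ∑ i, c i = 1) (hcy : ∑ i, c i • y i = 0)
    (hl : l ≠ 0) (hl0 : ∑ i, l i = 0) (hly : ∑ i, l i • y i = 0) :
    AffinelyIsomorphic {x : E | ∀ i, inner ℝ (y i) x ≤ 1}
      (simplexSection fun i => l i / c i) := by
  -- the linear part of the slack map
  let L : E →ₗ[ℝ] (ι → ℝ) := LinearMap.pi fun i => (-c i) • (innerₛₗ ℝ (y i))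
  have hL : ∀ x i, L x i = -c i * inner ℝ (y i) x := fun x i => by simp [L]
  have hker : LinearMap.ker L = ⊥ := by
    rw [LinearMap.ker_eq_bot']
    intro x hx
    have h0 : ∀ i, inner ℝ (y i) x = 0 := fun i => by
      have := congrFun hx i
      rw [hL] at this
      simpa [(hc i).ne'] using this
    have : ∀ v ∈ Submodule.span ℝ (Set.range y), inner ℝ v x = 0 := by
      intro v hv
      induction hv using Submodule.span_induction with
      | mem v hv => obtain ⟨i, rfl⟩ := hv; exact h0 i
      | zero => simp
      | add u v _ _ hu hv => rw [inner_add_left, hu, hv, add_zero]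
      | smul a v _ hv => rw [inner_smul_left, hv, mul_zero]
    exact inner_self_eq_zero.1 (this x (hspan ▸ Submodule.mem_top))
  obtain ⟨g, hg⟩ := L.exists_leftInverse_of_injective hker
  let φ : (ι → ℝ) →ₗ[ℝ] ℝ × ℝ :=
    (∑ i, LinearMap.proj i).prod (∑ i, (l i / c i) • LinearMap.proj i)
  have hφ : ∀ v, φ v = (∑ i, v i, ∑ i, l i / c i * v i) := fun v => by
    simp [φ]
  have hsumL : ∀ x, ∑ i, L x i = 0 := fun x => by
    have : inner ℝ (∑ i, c i • y i) x = 0 := by rw [hcy, inner_zero_left]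
    rw [sum_inner] at this
    simp only [inner_smul_left, conj_trivial] at this
    simp [hL, this]
  have hsumlL : ∀ x, ∑ i, l i / c i * L x i = 0 := fun x => by
    have : inner ℝ (∑ i, l i • y i) x = 0 := by rw [hly, inner_zero_left]
    rw [sum_inner] at this
    simp only [inner_smul_left, conj_trivial] at this
    rw [← neg_eq_zero, ← sum_neg_distrib, ← this]
    refine sum_congr rfl fun i _ => ?_
    rw [hL]
    have := (hc i).ne'
    field_simp
  have hrange : LinearMap.range L = LinearMap.ker φ := by
    refine Submodule.eq_of_le_of_finrank_eq ?_ ?_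
    · rintro _ ⟨x, rfl⟩
      rw [LinearMap.mem_ker, hφ, hsumL, hsumlL]
      rfl
    · have h1 := LinearMap.finrank_range_of_inj (LinearMap.ker_eq_bot.1 hker)
      have h2 := finrank_ker_sum_prod (μ := fun i => l i / c i) (by
        by_contra! h
        -- a constant quotient `l / c` would have to vanish
        apply hl
        funext i
        have hi : ∀ j, l j = l i / c i * c j := fun j => by
          rw [h i j, div_mul_cancel₀ _ (hc j).ne']
        have : ∑ j, l j = l i / c i := by
          rw [sum_congr rfl fun j _ => hi j, ← mul_sum, hc1, mul_one]
        rw [hl0] at this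
        rw [hi i, ← this, zero_mul]
        rfl) φ hφ
      omega
  refine ⟨L.toAffineMap + AffineMap.const ℝ E c, g.toAffineMap - AffineMap.const ℝ _ (g c), ?_, ?_⟩
  · ext z
    constructor
    · rintro ⟨x, hx, rfl⟩
      refine ⟨fun i => ?_, ?_, ?_⟩
      · have := mul_nonneg (hc i).le (sub_nonneg.2 (hx i))
        simp only [AffineMap.coe_add, Pi.add_apply, LinearMap.coe_toAffineMap,
          AffineMap.const_apply, hL]
        linarith
      · simp [sum_add_distrib, hsumL, hc1]
      · simp only [AffineMap.coe_add, Pi.add_apply, LinearMap.coe_toAffineMap,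
          AffineMap.const_apply, mul_add, sum_add_distrib, hsumlL, zero_add]
        rw [← hl0]
        exact sum_congr rfl fun i _ => div_mul_cancel₀ _ (hc i).ne'
    · rintro ⟨hz0, hz1, hzl⟩
      have hmem : z - c ∈ LinearMap.ker φ := by
        rw [LinearMap.mem_ker, hφ]
        simp only [Pi.sub_apply, mul_sub, sum_sub_distrib, hz1, hc1, hzl, sub_self, zero_sub]
        rw [sum_congr rfl fun i _ => div_mul_cancel₀ _ (hc i).ne', hl0, neg_zero]
        rfl
      rw [← hrange] at hmem
      obtain ⟨x, hx⟩ := hmem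
      refine ⟨x, fun i => ?_, ?_⟩
      · have h1 := hL x i
        rw [hx, Pi.sub_apply] at h1
        have h2 := hz0 i
        have h3 := hc i
        by_contra! h
        nlinarith
      · simp [hx]
  · intro x _
    have := LinearMap.congr_fun hg x
    simpa using this

end Slack

/-! ### Polars of polytopes -/

section Polar

theorem mem_dualPolytope {n : ℕ} {P : Set (EuclideanSpace ℝ (Fin n))}
    {y : EuclideanSpace ℝ (Fin n)} :
    y ∈ dualPolytope P ↔ ∀ x ∈ P, inner ℝ x y ≤ (1 : ℝ) := Iff.rfl

theorem mem_dualPolytope_convexHull {n : ℕ} {V : Set (EuclideanSpace ℝ (Fin n))}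
    {y : EuclideanSpace ℝ (Fin n)} :
    y ∈ dualPolytope (convexHull ℝ V) ↔ ∀ x ∈ V, inner ℝ x y ≤ (1 : ℝ) := by
  refine ⟨fun h x hx => h x (subset_convexHull ℝ V hx), fun h x hx => ?_⟩
  have hconv : Convex ℝ {x : EuclideanSpace ℝ (Fin n) | inner ℝ x y ≤ (1 : ℝ)} := by
    have := convex_halfSpace_le (𝕜 := ℝ) (f := fun x : EuclideanSpace ℝ (Fin n) => inner ℝ x y)
      (IsLinearMap.mk (fun a b => inner_add_left a b y)
        (fun a b => by simp [inner_smul_left])) 1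
    exact this
  exact convexHull_min h hconv hx

theorem convex_dualPolytope {n : ℕ} (P : Set (EuclideanSpace ℝ (Fin n))) :
    Convex ℝ (dualPolytope P) := by
  intro y hy z hz a b ha hb hab x hx
  rw [inner_add_right, inner_smul_right, inner_smul_right]
  nlinarith [hy x hx, hz x hx]

theorem isClosed_dualPolytope {n : ℕ} (P : Set (EuclideanSpace ℝ (Fin n))) :
    IsClosed (dualPolytope P) := by
  have : dualPolytope P = ⋂ x ∈ P, {y | inner ℝ x y ≤ (1 : ℝ)} := by
    ext y
    simp [mem_dualPolytope]
  rw [this]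
  exact isClosed_biInter fun x _ => isClosed_le (by fun_prop) continuous_const

theorem isCompact_dualPolytope {n : ℕ} {P : Set (EuclideanSpace ℝ (Fin n))}
    (h : 0 ∈ interior P) : IsCompact (dualPolytope P) := by
  refine Metric.isCompact_of_isClosed_isBounded (isClosed_dualPolytope P) ?_
  obtain ⟨r, hr, hball⟩ := Metric.mem_nhds_iff.1 (mem_interior_iff_mem_nhds.1 h)
  refine isBounded_iff_forall_norm_le.2 ⟨2 / r, fun y hy => ?_⟩
  rcases eq_or_ne y 0 with rfl | hy0
  · rw [norm_zero]
    positivity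
  have hn : 0 < ‖y‖ := norm_pos_iff.2 hy0
  have hx : (r / 2 / ‖y‖) • y ∈ P := by
    apply hball
    rw [mem_ball_zero_iff, norm_smul, Real.norm_of_nonneg (by positivity),
      div_mul_cancel₀ _ hn.ne']
    linarith
  have := hy _ hx
  rw [inner_smul_left, conj_trivial, real_inner_self_eq_norm_sq] at this
  rw [le_div_iff₀ hr]
  have h2 : r / 2 / ‖y‖ * ‖y‖ ^ 2 = r / 2 * ‖y‖ := by field_simp
  linarith

/-- The bipolar theorem combined with the Krein–Milman theorem. -/
theorem eq_setOf_forall_extremePoints {n : ℕ} {Q : Set (EuclideanSpace ℝ (Fin n))}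
    (hconv : Convex ℝ Q) (hclosed : IsClosed Q) (h0 : 0 ∈ interior Q) :
    Q = {x | ∀ y ∈ (dualPolytope Q).extremePoints ℝ, inner ℝ y x ≤ (1 : ℝ)} := by
  apply Set.Subset.antisymm
  · intro x hx y hy
    rw [real_inner_comm]
    exact hy.1 x hx
  · intro x hx
    by_contra hxQ
    obtain ⟨f, u, hu, hfx⟩ := geometric_hahn_banach_closed_point hconv hclosed hxQ
    have hu0 : 0 < u := by simpa using hu 0 (interior_subset h0)
    set w := (InnerProductSpace.toDual ℝ (EuclideanSpace ℝ (Fin n))).symm f with hw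
    have hfw : ∀ z, f z = inner ℝ w z := fun z => by
      rw [hw, InnerProductSpace.toDual_symm_apply]
    have hwQ : u⁻¹ • w ∈ dualPolytope Q := by
      intro z hz
      have := hu z hz
      rw [inner_smul_right, real_inner_comm, ← hfw, inv_mul_le_one₀ hu0]
      exact this.le
    have hsub : dualPolytope Q ⊆ {y | inner ℝ y x ≤ (1 : ℝ)} := by
      rw [← closure_convexHull_extremePoints (isCompact_dualPolytope h0) (convex_dualPolytope Q)]
      refine closure_minimal (convexHull_min hx ?_) (isClosed_le (by fun_prop) continuous_const)
      exact convex_halfSpace_le (𝕜 := ℝ) (f := fun y : EuclideanSpace ℝ (Fin n) => inner ℝ y x)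
        (IsLinearMap.mk (fun a b => inner_add_left a b x)
          (fun a b => by simp [inner_smul_left])) 1
    have := hsub hwQ
    rw [Set.mem_ofPred_eq, inner_smul_left, conj_trivial, ← hfw, inv_mul_le_one₀ hu0] at this
    linarith

/-- An extreme point of the polar of a polytope is determined by its tight inequalities: otherwise
it could be moved in both directions along a vector orthogonal to the tight points. -/
theorem span_tight_eq_top {n : ℕ} (V : Finset (EuclideanSpace ℝ (Fin n)))
    {y : EuclideanSpace ℝ (Fin n)}
    (hy : y ∈ (dualPolytope (convexHull ℝ (V : Set (EuclideanSpace ℝ (Fin n))))).extremePoints ℝ) :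
    Submodule.span ℝ {x ∈ convexHull ℝ (V : Set (EuclideanSpace ℝ (Fin n))) |
      inner ℝ x y = (1 : ℝ)} = ⊤ := by
  set K := Submodule.span ℝ {x ∈ convexHull ℝ (V : Set (EuclideanSpace ℝ (Fin n))) |
      inner ℝ x y = (1 : ℝ)} with hK
  by_contra hne
  obtain ⟨u, hu, hu0⟩ := Submodule.exists_mem_ne_zero_of_ne_bot
    (mt (Submodule.orthogonal_eq_bot_iff (K := K)).1 hne)
  have hy1 := mem_dualPolytope_convexHull.1 hy.1
  have hev : ∀ v : V, ∃ ε > (0 : ℝ), ∀ δ, |δ| ≤ ε → inner ℝ v.1 (y + δ • u) ≤ (1 : ℝ) := by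
    rintro ⟨v, hv⟩
    have h1 := hy1 v hv
    rcases h1.eq_or_lt with h | h
    · have : inner ℝ v u = (0 : ℝ) :=
        (Submodule.mem_orthogonal _ _).1 hu v
          (Submodule.subset_span ⟨subset_convexHull ℝ _ hv, h⟩)
      refine ⟨1, one_pos, fun δ _ => ?_⟩
      rw [inner_add_right, inner_smul_right, this, mul_zero, add_zero]
      exact h1
    · refine ⟨(1 - inner ℝ v y) / (|inner ℝ v u| + 1),
        div_pos (by linarith) (by positivity), fun δ hδ => ?_⟩
      rw [le_div_iff₀ (by positivity)] at hδ
      rw [inner_add_right, inner_smul_right]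
      have h2 := le_abs_self (δ * inner ℝ v u)
      rw [abs_mul] at h2
      have := abs_nonneg δ
      nlinarith
  choose f hf hf' using hev
  obtain ⟨ε, hε, hεf⟩ : ∃ ε > (0 : ℝ), ∀ v, ε ≤ f v := by
    rcases isEmpty_or_nonempty V with hV | hV
    · exact ⟨1, one_pos, fun v => hV.elim v⟩
    · obtain ⟨v, hv⟩ := Finite.exists_min f
      exact ⟨f v, hf v, hv⟩
  have hmem : ∀ δ, |δ| ≤ ε →
      y + δ • u ∈ dualPolytope (convexHull ℝ (V : Set (EuclideanSpace ℝ (Fin n)))) :=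
    fun δ hδ => mem_dualPolytope_convexHull.2 fun v hv => hf' ⟨v, hv⟩ δ (hδ.trans (hεf _))
  have hseg : y ∈ openSegment ℝ (y + ε • u) (y + (-ε) • u) := by
    refine ⟨1 / 2, 1 / 2, by norm_num, by norm_num, by norm_num, ?_⟩
    module
  have := hy.2 (hmem ε (abs_of_pos hε).le) (hmem (-ε) (by rw [abs_neg, abs_of_pos hε])) hseg
  rw [add_eq_left, smul_eq_zero] at this
  exact this.elim hε.ne' hu0

/-- If the points of a set span linearly, then its affine span has at most one dimension less. -/
theorem finrank_le_affDim_add_one {E : Type*} [NormedAddCommGroup E] [NormedSpace ℝ E]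
    [FiniteDimensional ℝ E] {A : Set E} (hA : Submodule.span ℝ A = ⊤) :
    Module.finrank ℝ E ≤ affDim A + 1 := by
  rcases A.eq_empty_or_nonempty with rfl | ⟨x, hx⟩
  · rw [Submodule.span_empty] at hA
    have := finrank_top ℝ E
    rw [← hA, finrank_bot] at this
    omega
  · have htop : (⊤ : Submodule ℝ E) ≤ vectorSpan ℝ A ⊔ ℝ ∙ x := by
      rw [← hA, Submodule.span_le]
      intro z hz
      have h1 : z - x ∈ vectorSpan ℝ A := vsub_mem_vectorSpan ℝ hz hx
      rw [SetLike.mem_coe, ← sub_add_cancel z x]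
      exact Submodule.add_mem_sup h1 (Submodule.mem_span_singleton_self x)
    rw [← finrank_top ℝ E]
    refine (Submodule.finrank_mono htop).trans
      ((Submodule.finrank_add_le_finrank_add_finrank _ _).trans ?_)
    have := finrank_span_le_card (R := ℝ) ({x} : Set E)
    rw [Set.toFinset_singleton, card_singleton] at this
    exact Nat.add_le_add_left this _

/-- A full-dimensional polytope with the origin in its interior is the solution set of as many
inequalities as it has facets: the extreme points of its polar give different facets. -/
theorem exists_eq_setOf_inner_le_one {d N : ℕ} (hd : 0 < d) (hN : N ≠ 0)
    (V : Finset (EuclideanSpace ℝ (Fin d)))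
    (h0 : 0 ∈ interior (convexHull ℝ (V : Set (EuclideanSpace ℝ (Fin d)))))
    (hdim : affDim (convexHull ℝ (V : Set (EuclideanSpace ℝ (Fin d)))) = d)
    (hfac : faceCount (d - 1) (convexHull ℝ (V : Set (EuclideanSpace ℝ (Fin d)))) = N) :
    ∃ y : Fin N → EuclideanSpace ℝ (Fin d),
      convexHull ℝ (V : Set (EuclideanSpace ℝ (Fin d))) = {x | ∀ i, inner ℝ (y i) x ≤ (1 : ℝ)} := by
  set Q := convexHull ℝ (V : Set (EuclideanSpace ℝ (Fin d))) with hQ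
  have hclosed : IsClosed Q := (V.finite_toSet.isCompact_convexHull ℝ).isClosed
  set X := (dualPolytope Q).extremePoints ℝ with hX
  have hmaps : ∀ y ∈ X, {x ∈ Q | inner ℝ x y = (1 : ℝ)} ∈
      {F : Set (EuclideanSpace ℝ (Fin d)) | F.Nonempty ∧ IsExposed ℝ Q F ∧ affDim F = d - 1} := by
    intro y hy
    have hspan := span_tight_eq_top V hy
    have hge := finrank_le_affDim_add_one hspan
    rw [finrank_euclideanSpace_fin] at hge
    have hne : {x ∈ Q | inner ℝ x y = (1 : ℝ)}.Nonempty := by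
      by_contra h
      rw [Set.not_nonempty_iff_eq_empty] at h
      rw [← hQ, h, Submodule.span_empty] at hspan
      have := finrank_top ℝ (EuclideanSpace ℝ (Fin d))
      rw [← hspan, finrank_bot, finrank_euclideanSpace_fin] at this
      omega
    have hexp : IsExposed ℝ Q {x ∈ Q | inner ℝ x y = (1 : ℝ)} := by
      rintro ⟨x₀, hx₀, hx₀y⟩
      refine ⟨innerSL ℝ y, ?_⟩
      ext x
      simp only [Set.mem_ofPred_eq, innerSL_apply_apply, real_inner_comm _ y]
      refine and_congr_right fun hx => ⟨fun h z hz => h ▸ hy.1 z hz, fun h => ?_⟩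
      exact le_antisymm (hy.1 x hx) (hx₀y ▸ h x₀ hx₀)
    refine ⟨hne, hexp, ?_⟩
    have hlt : affDim {x ∈ Q | inner ℝ x y = (1 : ℝ)} < affDim Q := by
      refine affDim_lt_of_isExposed hexp hne ⟨fun x hx => hx.1, fun h => ?_⟩ subset_rfl
      have := (h (interior_subset h0)).2
      simp at this
    change Module.finrank ℝ _ = _
    change _ ≤ affDim {x ∈ Q | inner ℝ x y = (1 : ℝ)} + 1 at hge
    change affDim {x ∈ Q | inner ℝ x y = (1 : ℝ)} = _
    omega
  have hinj : Set.InjOn (fun y => {x ∈ Q | inner ℝ x y = (1 : ℝ)}) X := by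
    intro y hy z hz h
    have hspan := span_tight_eq_top V hy
    have h1 : ∀ x ∈ Submodule.span ℝ {x ∈ Q | inner ℝ x y = (1 : ℝ)},
        inner ℝ x (y - z) = (0 : ℝ) := by
      intro x hx
      induction hx using Submodule.span_induction with
      | mem x hx =>
        have hx' : x ∈ {x ∈ Q | inner ℝ x z = (1 : ℝ)} := by
          simp only at h
          rwa [← h]
        rw [inner_sub_right, hx.2, hx'.2, sub_self]
      | zero => simp
      | add u v _ _ hu hv => rw [inner_add_left, hu, hv, add_zero]
      | smul a v _ hv => rw [inner_smul_left, hv, mul_zero]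
    exact sub_eq_zero.1 (inner_self_eq_zero.1 (h1 _ (hspan ▸ Submodule.mem_top)))
  have hfin : {F : Set (EuclideanSpace ℝ (Fin d)) |
      F.Nonempty ∧ IsExposed ℝ Q F ∧ affDim F = d - 1}.Finite :=
    Set.finite_of_ncard_ne_zero (by rw [faceCount] at hfac; omega)
  have hXfin : X.Finite := Set.Finite.of_injOn hmaps hinj hfin
  have hXcard : X.ncard ≤ N := hfac ▸ Set.ncard_le_ncard_of_injOn _ hmaps hinj hfin
  obtain ⟨y₀, hy₀⟩ : X.Nonempty := (isCompact_dualPolytope h0).extremePoints_nonempty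
    ⟨0, fun x _ => by simp⟩
  have : Nonempty X := ⟨⟨y₀, hy₀⟩⟩
  have := hXfin.to_subtype
  obtain ⟨g⟩ : Nonempty (X ↪ Fin N) := by
    rw [Set.ncard, Set.encard] at hXcard
    have := Fintype.ofFinite X
    refine Function.Embedding.nonempty_of_card_le ?_
    rw [Fintype.card_fin, ← Nat.card_eq_fintype_card]
    exact hXcard
  refine ⟨fun i => (Function.invFun g i).1, ?_⟩
  refine (eq_setOf_forall_extremePoints (convex_convexHull ℝ _) hclosed h0).trans ?_
  ext x
  constructor
  · exact fun h i => h _ (Function.invFun g i).2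
  · intro h y hy
    obtain ⟨i, hi⟩ := Function.invFun_surjective g.injective ⟨y, hy⟩
    have h1 : inner ℝ (Function.invFun g i).1 x ≤ (1 : ℝ) := h i
    rwa [hi] at h1

end Polar

/-! ### Polytopes with `d + 2` facets as sections of a simplex -/

section FromPolytopeToSection

/-- Every polytope is affinely isomorphic to a full-dimensional one with the origin in its
interior. -/
theorem exists_affinelyIsomorphic_zero_mem_interior {n d : ℕ} {P : Set (EuclideanSpace ℝ (Fin n))}
    (hP : IsPolytopeOfDim d P) :
    ∃ V : Finset (EuclideanSpace ℝ (Fin d)),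
      AffinelyIsomorphic P (convexHull ℝ (V : Set (EuclideanSpace ℝ (Fin d)))) ∧
      0 ∈ interior (convexHull ℝ (V : Set (EuclideanSpace ℝ (Fin d)))) ∧
      affDim (convexHull ℝ (V : Set (EuclideanSpace ℝ (Fin d)))) = d := by
  classical
  obtain ⟨⟨V, ⟨x₀, hx₀⟩, hPV⟩, hdim⟩ := hP
  have hx₀P : x₀ ∈ P := hPV ▸ subset_convexHull ℝ _ hx₀
  let e : vectorSpan ℝ P ≃ₗ[ℝ] EuclideanSpace ℝ (Fin d) :=
    LinearEquiv.ofFinrankEq _ _ (by rw [finrank_euclideanSpace_fin]; exact hdim)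
  obtain ⟨π, hπ⟩ := (vectorSpan ℝ P).subtype.exists_leftInverse_of_injective
    (Submodule.ker_subtype _)
  let f₁ : EuclideanSpace ℝ (Fin n) →ᵃ[ℝ] EuclideanSpace ℝ (Fin d) :=
    (e.toLinearMap ∘ₗ π).toAffineMap - AffineMap.const ℝ _ (e (π x₀))
  have hf₁ : ∀ x, f₁ x = e (π (x - x₀)) := fun x => by simp [f₁]
  have hg₁ : ∀ x ∈ P, ((e.symm (f₁ x) : vectorSpan ℝ P) : EuclideanSpace ℝ (Fin n)) + x₀ = x := by
    intro x hx
    have hm : x - x₀ ∈ vectorSpan ℝ P := vsub_mem_vectorSpan ℝ hx hx₀P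
    have := LinearMap.congr_fun hπ ⟨x - x₀, hm⟩
    simp only [LinearMap.comp_apply, Submodule.subtype_apply, LinearMap.id_apply] at this
    rw [hf₁, e.symm_apply_apply, this, sub_add_cancel]
  let g₁ : EuclideanSpace ℝ (Fin d) →ᵃ[ℝ] EuclideanSpace ℝ (Fin n) :=
    ((vectorSpan ℝ P).subtype ∘ₗ e.symm.toLinearMap).toAffineMap + AffineMap.const ℝ _ x₀
  have hgf₁ : ∀ x ∈ P, g₁ (f₁ x) = x := fun x hx => by simpa [g₁] using hg₁ x hx
  have hdim₁ : affDim (f₁ '' P) = d := (affDim_image_of_leftInvOn f₁ g₁ hgf₁).trans hdim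
  have hconv : Convex ℝ (f₁ '' P) := by
    rw [hPV]
    exact (convex_convexHull ℝ _).affine_image f₁
  obtain ⟨z, hz⟩ : (interior (f₁ '' P)).Nonempty := by
    rw [hconv.interior_nonempty_iff_affineSpan_eq_top,
      AffineSubspace.affineSpan_eq_top_iff_vectorSpan_eq_top_of_nonempty ℝ _ _
        (Set.Nonempty.image _ ⟨x₀, hx₀P⟩)]
    apply Submodule.eq_top_of_finrank_eq
    rw [finrank_euclideanSpace_fin]
    exact hdim₁
  let f : EuclideanSpace ℝ (Fin n) →ᵃ[ℝ] EuclideanSpace ℝ (Fin d) := f₁ - AffineMap.const ℝ _ z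
  let g : EuclideanSpace ℝ (Fin d) →ᵃ[ℝ] EuclideanSpace ℝ (Fin n) :=
    g₁.comp (AffineMap.id ℝ _ + AffineMap.const ℝ _ z)
  have hgf : ∀ x ∈ P, g (f x) = x := fun x hx => by
    simpa [f, g] using hgf₁ x hx
  have himage : f '' P = convexHull ℝ ((V.image f : Finset (EuclideanSpace ℝ (Fin d))) :
      Set (EuclideanSpace ℝ (Fin d))) := by
    rw [hPV, AffineMap.image_convexHull, coe_image]
  refine ⟨V.image f, himage ▸ ⟨f, g, rfl, hgf⟩, himage ▸ ?_,
    himage ▸ (affDim_image_of_leftInvOn f g hgf).trans hdim⟩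
  have htrans : f '' P = Homeomorph.subRight z '' (f₁ '' P) := by
    rw [Set.image_image]
    rfl
  rw [htrans, ← Homeomorph.image_interior]
  exact ⟨z, hz, by simp⟩

variable {ι : Type*} {E : Type*} [NormedAddCommGroup E] [InnerProductSpace ℝ E]

/-- A bounded polyhedron has no recession direction. -/
theorem eq_zero_of_isBounded {y : ι → E}
    (hb : Bornology.IsBounded {x | ∀ i, inner ℝ (y i) x ≤ (1 : ℝ)}) {x : E}
    (hx : ∀ i, inner ℝ (y i) x ≤ (0 : ℝ)) : x = 0 := by
  obtain ⟨C, hC⟩ := isBounded_iff_forall_norm_le.1 hb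
  by_contra h0
  have hn : 0 < ‖x‖ := norm_pos_iff.2 h0
  have hC' := hC (((|C| + 1) / ‖x‖) • x) fun i => by
    rw [inner_smul_right]
    have := mul_nonpos_of_nonneg_of_nonpos (a := (|C| + 1) / ‖x‖) (by positivity) (hx i)
    linarith
  rw [norm_smul, Real.norm_of_nonneg (by positivity), div_mul_cancel₀ _ hn.ne'] at hC'
  linarith [le_abs_self C]

variable [FiniteDimensional ℝ E]

theorem span_eq_top_of_isBounded {y : ι → E}
    (hb : Bornology.IsBounded {x | ∀ i, inner ℝ (y i) x ≤ (1 : ℝ)}) :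
    Submodule.span ℝ (Set.range y) = ⊤ := by
  rw [← Submodule.orthogonal_eq_bot_iff, Submodule.eq_bot_iff]
  intro x hx
  exact eq_zero_of_isBounded hb fun i =>
    ((Submodule.mem_orthogonal _ _).1 hx _ (Submodule.subset_span ⟨i, rfl⟩)).le

variable [Fintype ι]

/-- The normal vectors of a bounded polyhedron have a strictly positive linear dependence: the set
of their strictly positive combinations is open, and a functional separating it from the origin
would give an unbounded direction. -/
theorem exists_pos_sum_smul_eq_zero [Nonempty ι] {y : ι → E}
    (hb : Bornology.IsBounded {x | ∀ i, inner ℝ (y i) x ≤ (1 : ℝ)}) :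
    ∃ c : ι → ℝ, (∀ i, 0 < c i) ∧ ∑ i, c i = 1 ∧ ∑ i, c i • y i = 0 := by
  classical
  let L : (ι → ℝ) →ₗ[ℝ] E := Fintype.linearCombination ℝ y
  have hL : ∀ c, L c = ∑ i, c i • y i := fun c => Fintype.linearCombination_apply ℝ y c
  have hsurj : Function.Surjective L := by
    rw [← LinearMap.range_eq_top, Fintype.range_linearCombination]
    exact span_eq_top_of_isBounded hb
  have hopen : IsOpen (L '' Set.pi Set.univ fun _ => Set.Ioi 0) :=
    (L.toContinuousLinearMap.isOpenMap hsurj) _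
      (isOpen_set_pi Set.finite_univ fun _ _ => isOpen_Ioi)
  have hconv : Convex ℝ (L '' Set.pi Set.univ fun _ => Set.Ioi (0 : ℝ)) :=
    (convex_pi fun _ _ => convex_Ioi 0).linear_image L
  have hmem : (0 : E) ∈ L '' Set.pi Set.univ fun _ => Set.Ioi (0 : ℝ) := by
    by_contra h0
    obtain ⟨f, hf⟩ := geometric_hahn_banach_open_point hconv hopen h0
    rw [map_zero] at hf
    have hf' : ∀ c : ι → ℝ, (∀ i, 0 < c i) → f (L c) < 0 := fun c hc =>
      hf _ ⟨c, fun i _ => hc i, rfl⟩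
    have hle : ∀ i, f (y i) ≤ 0 := by
      intro i
      by_contra! hi
      set s := f (L fun _ => 1) with hs
      have hs0 : s < 0 := hf' _ fun _ => one_pos
      have h1 := hf' ((fun _ => 1) + Pi.single i (-s / f (y i))) fun j => by
        have : 0 ≤ (Pi.single i (-s / f (y i)) : ι → ℝ) j := by
          rw [Pi.single_apply]
          split_ifs
          · exact div_nonneg (by linarith) hi.le
          · exact le_rfl
        simp only [Pi.add_apply]
        linarith
      have h2 : L (Pi.single i (-s / f (y i))) = (-s / f (y i)) • y i :=
        Fintype.linearCombination_apply_single ℝ y i _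
      rw [map_add, map_add, h2, map_smul, smul_eq_mul, div_mul_cancel₀ _ hi.ne', ← hs] at h1
      linarith
    set w := (InnerProductSpace.toDual ℝ E).symm f with hw
    have hfw : ∀ z, f z = inner ℝ w z := fun z => by
      rw [hw, InnerProductSpace.toDual_symm_apply]
    have hw0 : w = 0 := eq_zero_of_isBounded hb fun i => by
      rw [real_inner_comm, ← hfw]
      exact hle i
    have := hf' (fun _ => 1) fun _ => one_pos
    rw [hfw, hw0, inner_zero_left] at this
    exact lt_irrefl _ this
  obtain ⟨c, hc, hc0⟩ := hmem
  have hc' : ∀ i, 0 < c i := fun i => hc i trivial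
  have hpos : 0 < ∑ i, c i := sum_pos (fun i _ => hc' i) univ_nonempty
  refine ⟨fun i => c i / ∑ i, c i, fun i => div_pos (hc' i) hpos, ?_, ?_⟩
  · rw [← sum_div, div_self hpos.ne']
  · rw [hL] at hc0
    simp only [div_eq_inv_mul, mul_smul]
    rw [← smul_sum, hc0, smul_zero]

theorem exists_affine_dependence (y : ι → E) (hcard : Module.finrank ℝ E + 1 < Fintype.card ι) :
    ∃ l : ι → ℝ, l ≠ 0 ∧ ∑ i, l i = 0 ∧ ∑ i, l i • y i = 0 := by
  let φ : (ι → ℝ) →ₗ[ℝ] E × ℝ :=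
    (Fintype.linearCombination ℝ y).prod (∑ i, LinearMap.proj i)
  have hker : LinearMap.ker φ ≠ ⊥ := by
    apply LinearMap.ker_ne_bot_of_finrank_lt
    rwa [Module.finrank_prod, Module.finrank_self, Module.finrank_fintype_fun_eq_card]
  obtain ⟨l, hl, hl0⟩ := Submodule.exists_mem_ne_zero_of_ne_bot hker
  rw [LinearMap.mem_ker] at hl
  refine ⟨l, hl0, ?_, ?_⟩
  · simpa [φ] using congrArg Prod.snd hl
  · simpa [φ, Fintype.linearCombination_apply] using congrArg Prod.fst hl

theorem exists_pos_and_exists_neg {l : ι → ℝ} (hl : l ≠ 0) (hl0 : ∑ i, l i = 0) :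
    (∃ i, 0 < l i) ∧ ∃ i, l i < 0 := by
  constructor
  · by_contra! h
    apply hl
    funext i
    have := (sum_eq_zero_iff_of_nonpos fun i _ => h i).1 hl0 i (mem_univ i)
    simpa using this
  · by_contra! h
    apply hl
    funext i
    have := (sum_eq_zero_iff_of_nonneg fun i _ => h i).1 hl0 i (mem_univ i)
    simpa using this

/-- The face numbers of a `d`-polytope with `d + 2` facets are determined by the signs in its
Gale diagram. -/
theorem exists_faceCount_eq_galeFaceCount {n d : ℕ} (hd : 0 < d)
    {Q : Set (EuclideanSpace ℝ (Fin n))} (hQ : IsPolytopeOfDim d Q)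
    (hfac : faceCount (d - 1) Q = d + 2) :
    ∃ p q, 1 ≤ p ∧ 1 ≤ q ∧ p + q ≤ d + 2 ∧
      ∀ k, (faceCount k Q : ℤ) = galeFaceCount k d p q := by
  obtain ⟨V, hiso, h0, hdim⟩ := exists_affinelyIsomorphic_zero_mem_interior hQ
  rw [hiso.faceCount_eq] at hfac
  obtain ⟨y, hy⟩ := exists_eq_setOf_inner_le_one hd (by omega) V h0 hdim hfac
  have hb : Bornology.IsBounded {x | ∀ i, inner ℝ (y i) x ≤ (1 : ℝ)} :=
    hy ▸ (V.finite_toSet.isCompact_convexHull ℝ).isBounded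
  obtain ⟨c, hc, hc1, hcy⟩ := exists_pos_sum_smul_eq_zero hb
  obtain ⟨l, hl, hl0, hly⟩ := exists_affine_dependence y (by simp)
  have hsec := affinelyIsomorphic_simplexSection y c l (by simp) (span_eq_top_of_isBounded hb)
    hc hc1 hcy hl hl0 hly
  rw [← hy] at hsec
  obtain ⟨e₁, -⟩ := hiso.exists_orderIso
  obtain ⟨e₂, -⟩ := hsec.exists_orderIso
  obtain ⟨e₃⟩ := nonempty_orderIso_simplexSection fun i => l i / c i
  obtain ⟨⟨i, hi⟩, ⟨j, hj⟩⟩ := exists_pos_and_exists_neg hl hl0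
  have : Nonempty {i // 0 < l i / c i} := ⟨⟨i, div_pos hi (hc i)⟩⟩
  have : Nonempty {i // l i / c i < 0} := ⟨⟨j, div_neg_of_neg_of_pos hj (hc j)⟩⟩
  refine ⟨Nat.card {i // 0 < l i / c i}, Nat.card {i // l i / c i < 0}, Nat.card_pos, Nat.card_pos,
    ?_, fun k => ?_⟩
  · classical
    rw [Nat.card_eq_fintype_card, Nat.card_eq_fintype_card, Fintype.card_subtype,
      Fintype.card_subtype, ← card_union_of_disjoint]
    · exact (card_le_univ _).trans (by simp)
    · rw [disjoint_filter]
      intro i _ h1 h2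
      linarith
  · exact faceCount_eq_galeFaceCount (e₁.trans (e₂.trans e₃)) (by simp) hQ.2 rfl rfl
      Nat.card_pos Nat.card_pos k

end FromPolytopeToSection

/-! ### Gale data of iterated pyramids over sums of simplices -/

section GaleData

/-- `P` is the convex hull of `n + 2` linearly spanning points of `ℝⁿ` that have a strictly
positive linear dependence `c` and an affine dependence `l` with `p` positive and `q` negative
coefficients. -/
def HasGaleData {n : ℕ} (P : Set (EuclideanSpace ℝ (Fin n))) (p q : ℕ) : Prop :=
  ∃ (ι : Type) (_ : Fintype ι) (v : ι → EuclideanSpace ℝ (Fin n)) (c l : ι → ℝ),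
    Fintype.card ι = n + 2 ∧ P = convexHull ℝ (Set.range v) ∧
    Submodule.span ℝ (Set.range v) = ⊤ ∧ (∀ i, 0 < c i) ∧ ∑ i, c i • v i = 0 ∧
    ∑ i, l i = 0 ∧ ∑ i, l i • v i = 0 ∧
    Nat.card {i // 0 < l i} = p ∧ Nat.card {i // l i < 0} = q

theorem natCard_subtype_eq {α β : Type*} {r : α → Prop} {t : β → Prop} (f : α → β)
    (hf : Function.Injective f) (h : ∀ b, t b ↔ ∃ a, r a ∧ f a = b) :
    Nat.card {b // t b} = Nat.card {a // r a} := by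
  refine (Nat.card_congr (Equiv.ofBijective
    (fun a : {a // r a} => (⟨f a.1, (h _).2 ⟨a.1, a.2, rfl⟩⟩ : {b // t b})) ⟨?_, ?_⟩)).symm
  · intro a b hab
    exact Subtype.ext (hf (congrArg Subtype.val hab))
  · rintro ⟨b, hb⟩
    obtain ⟨a, ha, rfl⟩ := (h b).1 hb
    exact ⟨⟨a, ha⟩, rfl⟩

/-- The inclusion of `ℝⁿ` as the first coordinates of `ℝⁿ⁺¹`. -/
noncomputable def snocZero (n : ℕ) :
    EuclideanSpace ℝ (Fin n) →ₗ[ℝ] EuclideanSpace ℝ (Fin (n + 1)) where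
  toFun p := WithLp.toLp 2 (Fin.snoc (α := fun _ => ℝ) (WithLp.ofLp p) (0 : ℝ))
  map_add' p q := by
    ext i
    refine Fin.lastCases ?_ (fun j => ?_) i <;> simp
  map_smul' a p := by
    ext i
    refine Fin.lastCases ?_ (fun j => ?_) i <;> simp

/-- The last standard basis vector of `ℝⁿ⁺¹`. -/
noncomputable def lastVec (n : ℕ) : EuclideanSpace ℝ (Fin (n + 1)) :=
  WithLp.toLp 2 (Fin.snoc (α := fun _ => ℝ) (0 : Fin n → ℝ) (1 : ℝ))

theorem toLp_snoc (n : ℕ) (p : EuclideanSpace ℝ (Fin n)) (t : ℝ) :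
    WithLp.toLp 2 (Fin.snoc (α := fun _ => ℝ) (WithLp.ofLp p) t)
      = snocZero n p + t • lastVec n := by
  ext i
  refine Fin.lastCases ?_ (fun j => ?_) i <;> simp [snocZero, lastVec]

/-- A pyramid adds a point on which the affine dependence vanishes. -/
theorem HasGaleData.pyramid {n p q : ℕ} {P : Set (EuclideanSpace ℝ (Fin n))}
    (h : HasGaleData P p q) : HasGaleData (pyramid P) p q := by
  obtain ⟨ι, _, v, c, l, hcard, hP, hspan, hc, hcv, hl, hlv, hp, hq⟩ := h
  have : Nonempty ι := by
    rw [← Fintype.card_pos_iff]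
    omega
  let w : Option ι → EuclideanSpace ℝ (Fin (n + 1)) := fun o =>
    o.elim (lastVec n) fun i => snocZero n (v i) - lastVec n
  let f : EuclideanSpace ℝ (Fin n) →ᵃ[ℝ] EuclideanSpace ℝ (Fin (n + 1)) :=
    (snocZero n).toAffineMap - AffineMap.const ℝ _ (lastVec n)
  -- the weight of the apex, at height `1`, balances the base, at height `-1`
  refine ⟨Option ι, inferInstance, w, fun o => o.elim (∑ i, c i) c, fun o => o.elim 0 l,
    by simp [hcard], ?_, ?_, ?_, ?_, ?_, ?_, ?_, ?_⟩
  · have h1 : (fun p : EuclideanSpace ℝ (Fin n) =>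
        WithLp.toLp 2 (Fin.snoc (α := fun _ => ℝ) (WithLp.ofLp p) (-1 : ℝ))) = f := by
      funext p
      rw [toLp_snoc]
      simp [f, sub_eq_add_neg]
    have h2 : Set.range w = {lastVec n} ∪ f '' Set.range v := by
      rw [Option.range_eq, Set.singleton_union, ← Set.range_comp]
      rfl
    rw [h2, ← convexHull_convexHull_union_right, ← AffineMap.image_convexHull,
      ← hP, Set.singleton_union, ← h1]
    rfl
  · rw [eq_top_iff]
    rintro x -
    have he : lastVec n ∈ Submodule.span ℝ (Set.range w) := Submodule.subset_span ⟨none, rfl⟩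
    have hA : ∀ y, snocZero n y ∈ Submodule.span ℝ (Set.range w) := by
      intro y
      have hy : y ∈ Submodule.span ℝ (Set.range v) := hspan ▸ Submodule.mem_top
      induction hy using Submodule.span_induction with
      | mem y hy =>
        obtain ⟨i, rfl⟩ := hy
        have : w (some i) ∈ Submodule.span ℝ (Set.range w) := Submodule.subset_span ⟨_, rfl⟩
        rw [← sub_add_cancel (snocZero n (v i)) (lastVec n)]
        exact add_mem this he
      | zero => rw [map_zero]; exact zero_mem _
      | add y z _ _ hy hz => rw [map_add]; exact add_mem hy hz
      | smul a y _ hy => rw [map_smul]; exact Submodule.smul_mem _ _ hy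
    have hx : x = snocZero n (WithLp.toLp 2 fun i => x i.castSucc)
        + x (Fin.last n) • lastVec n := by
      rw [← toLp_snoc]
      ext i
      refine Fin.lastCases ?_ (fun j => ?_) i <;> simp
    rw [hx]
    exact add_mem (hA _) (Submodule.smul_mem _ _ he)
  · rintro (_ | i)
    · exact sum_pos (fun i _ => hc i) univ_nonempty
    · exact hc i
  · rw [Fintype.sum_option]
    simp only [w, Option.elim, smul_sub, sum_sub_distrib, ← map_smul, ← map_sum, hcv, map_zero,
      ← sum_smul]
    simp
  · rw [Fintype.sum_option]
    simp [hl]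
  · rw [Fintype.sum_option]
    simp only [w, Option.elim, smul_sub, sum_sub_distrib, ← map_smul, ← map_sum, hlv, map_zero,
      ← sum_smul, hl]
    simp
  · rw [← hp]
    refine natCard_subtype_eq some (Option.some_injective _) ?_
    rintro (_ | i) <;> simp
  · rw [← hq]
    refine natCard_subtype_eq some (Option.some_injective _) ?_
    rintro (_ | i) <;> simp

theorem HasGaleData.iterPyramid {n p q : ℕ} {P : Set (EuclideanSpace ℝ (Fin n))}
    (h : HasGaleData P p q) : ∀ r, HasGaleData (iterPyramid P r) p q
  | 0 => h
  | r + 1 => (h.iterPyramid r).pyramid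

/-- The vertices of the simplex `T(m)`. -/
noncomputable def simplexVertex (m : ℕ) (o : Option (Fin m)) : EuclideanSpace ℝ (Fin m) :=
  o.elim (-∑ i, EuclideanSpace.single i (1 : ℝ)) fun i => EuclideanSpace.single i (1 : ℝ)

theorem simplexT_eq (m : ℕ) : simplexT m = convexHull ℝ (Set.range (simplexVertex m)) := by
  rw [Option.range_eq]
  rfl

theorem sum_simplexVertex (m : ℕ) : ∑ o, simplexVertex m o = 0 := by
  rw [Fintype.sum_option]
  exact neg_add_cancel _

theorem span_simplexVertex (m : ℕ) : Submodule.span ℝ (Set.range (simplexVertex m)) = ⊤ := by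
  rw [eq_top_iff, ← (EuclideanSpace.basisFun (Fin m) ℝ).toBasis.span_eq]
  refine Submodule.span_mono ?_
  rintro _ ⟨i, rfl⟩
  exact ⟨some i, by simp [simplexVertex]⟩

/-- The inclusion of the first summand. -/
noncomputable def appendZero (m n : ℕ) :
    EuclideanSpace ℝ (Fin m) →ₗ[ℝ] EuclideanSpace ℝ (Fin (m + n)) where
  toFun p := WithLp.toLp 2 (Fin.append (WithLp.ofLp p) (0 : Fin n → ℝ))
  map_add' p q := by
    ext i
    refine Fin.addCases (fun j => ?_) (fun j => ?_) i <;> simp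
  map_smul' a p := by
    ext i
    refine Fin.addCases (fun j => ?_) (fun j => ?_) i <;> simp

/-- The inclusion of the second summand. -/
noncomputable def zeroAppend (m n : ℕ) :
    EuclideanSpace ℝ (Fin n) →ₗ[ℝ] EuclideanSpace ℝ (Fin (m + n)) where
  toFun p := WithLp.toLp 2 (Fin.append (0 : Fin m → ℝ) (WithLp.ofLp p))
  map_add' p q := by
    ext i
    refine Fin.addCases (fun j => ?_) (fun j => ?_) i <;> simp
  map_smul' a p := by
    ext i
    refine Fin.addCases (fun j => ?_) (fun j => ?_) i <;> simp

/-- In a direct sum of two simplices the vertices of either summand sum to zero. -/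
theorem hasGaleData_directSum (m n : ℕ) :
    HasGaleData (directSum (simplexT m) (simplexT n)) (m + 1) (n + 1) := by
  let w : Option (Fin m) ⊕ Option (Fin n) → EuclideanSpace ℝ (Fin (m + n)) :=
    Sum.elim (appendZero m n ∘ simplexVertex m) (zeroAppend m n ∘ simplexVertex n)
  have hsum₁ : ∑ o, appendZero m n (simplexVertex m o) = 0 := by
    rw [← map_sum, sum_simplexVertex, map_zero]
  have hsum₂ : ∑ o, zeroAppend m n (simplexVertex n o) = 0 := by
    rw [← map_sum, sum_simplexVertex, map_zero]
  have hm : (0 : ℝ) < (m + 1 : ℝ)⁻¹ := by positivity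
  have hn : (0 : ℝ) < (n + 1 : ℝ)⁻¹ := by positivity
  refine ⟨_, inferInstance, w, fun _ => 1,
    Sum.elim (fun _ => (m + 1 : ℝ)⁻¹) (fun _ => -(n + 1 : ℝ)⁻¹),
    by simp; omega, ?_, ?_, fun _ => one_pos, ?_, ?_, ?_, ?_, ?_⟩
  · have h : Set.range w = appendZero m n '' Set.range (simplexVertex m)
        ∪ zeroAppend m n '' Set.range (simplexVertex n) := by
      rw [Set.Sum.elim_range, Set.range_comp, Set.range_comp]
    rw [h, ← convexHull_convexHull_union_left, ← convexHull_convexHull_union_right,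
      ← LinearMap.image_convexHull, ← LinearMap.image_convexHull, ← simplexT_eq, ← simplexT_eq]
    rfl
  · rw [eq_top_iff]
    rintro x -
    have h1 : ∀ y, appendZero m n y ∈ Submodule.span ℝ (Set.range w) := by
      intro y
      have hy : appendZero m n y ∈ Submodule.map (appendZero m n)
          (Submodule.span ℝ (Set.range (simplexVertex m))) :=
        Submodule.mem_map_of_mem (span_simplexVertex m ▸ Submodule.mem_top)
      rw [Submodule.map_span, ← Set.range_comp] at hy
      refine Submodule.span_mono ?_ hy
      rintro _ ⟨o, rfl⟩
      exact ⟨Sum.inl o, rfl⟩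
    have h2 : ∀ y, zeroAppend m n y ∈ Submodule.span ℝ (Set.range w) := by
      intro y
      have hy : zeroAppend m n y ∈ Submodule.map (zeroAppend m n)
          (Submodule.span ℝ (Set.range (simplexVertex n))) :=
        Submodule.mem_map_of_mem (span_simplexVertex n ▸ Submodule.mem_top)
      rw [Submodule.map_span, ← Set.range_comp] at hy
      refine Submodule.span_mono ?_ hy
      rintro _ ⟨o, rfl⟩
      exact ⟨Sum.inr o, rfl⟩
    have hx : x = appendZero m n (WithLp.toLp 2 fun i => x (Fin.castAdd n i))
        + zeroAppend m n (WithLp.toLp 2 fun i => x (Fin.natAdd m i)) := by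
      ext i
      refine Fin.addCases (fun j => ?_) (fun j => ?_) i <;> simp [appendZero, zeroAppend]
    rw [hx]
    exact add_mem (h1 _) (h2 _)
  · simp [Fintype.sum_sum_type, w, hsum₁, hsum₂, -Fintype.sum_option]
  · simp only [Fintype.sum_sum_type, Sum.elim_inl, Sum.elim_inr, sum_const, card_univ,
      Fintype.card_option, Fintype.card_fin, nsmul_eq_mul]
    push_cast
    field_simp
    ring
  · simp only [Fintype.sum_sum_type, w, Sum.elim_inl, Sum.elim_inr, Function.comp_apply,
      ← smul_sum, hsum₁, hsum₂]
    simp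
  · rw [natCard_subtype_eq (r := fun _ : Option (Fin m) => True) Sum.inl Sum.inl_injective]
    · simp
    · rintro (o | o) <;> simp <;> positivity
  · rw [natCard_subtype_eq (r := fun _ : Option (Fin n) => True) Sum.inr Sum.inr_injective]
    · simp
    · rintro (o | o) <;> simp <;> positivity

theorem hasGaleData_polyT (m d a : ℕ) : HasGaleData (polyT m d a) (m + 1) (a - m + 1) :=
  (hasGaleData_directSum m (a - m)).iterPyramid (d - a)

theorem AffinelyIsomorphic.exists_eq_convexHull_of_simplexSection {ι : Type*} [Fintype ι] {n : ℕ}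
    {P : Set (EuclideanSpace ℝ (Fin n))} {μ : ι → ℝ}
    (h : AffinelyIsomorphic P (simplexSection μ)) :
    ∃ V : Finset (EuclideanSpace ℝ (Fin n)),
      P = convexHull ℝ (V : Set (EuclideanSpace ℝ (Fin n))) := by
  obtain ⟨f, -, rfl, -⟩ := h.symm
  have hfin := finite_extremePoints_simplexSection (μ := μ)
  have h1 : simplexSection μ = convexHull ℝ ((simplexSection μ).extremePoints ℝ) := by
    rw [← (hfin.isCompact_convexHull ℝ).isClosed.closure_eq,
      closure_convexHull_extremePoints isCompact_simplexSection convex_simplexSection]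
  refine ⟨(hfin.image f).toFinset, ?_⟩
  rw [Set.Finite.coe_toFinset, ← AffineMap.image_convexHull, ← h1]

/-- The dual of a polytope with Gale data is a polytope, and its face lattice is the poset of
balanced sets of a sign vector with the same numbers of signs. -/
theorem HasGaleData.isPolytopeOfDim_dualPolytope {n p q : ℕ} {P : Set (EuclideanSpace ℝ (Fin n))}
    (h : HasGaleData P p q) (hp0 : 0 < p) :
    IsPolytopeOfDim n (dualPolytope P) ∧
    ∃ (ι : Type) (_ : Fintype ι) (μ : ι → ℝ), Fintype.card ι = n + 2 ∧
      Nat.card {i // 0 < μ i} = p ∧ Nat.card {i // μ i < 0} = q ∧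
      Nonempty (FaceLattice (dualPolytope P) ≃o {S : Finset ι // IsBalanced μ S}) := by
  obtain ⟨ι, _, v, c, l, hcard, hP, hspan, hc, hcv, hl, hlv, hp, hq⟩ := h
  have : Nonempty ι := by
    rw [← Fintype.card_pos_iff]
    omega
  have hl0 : l ≠ 0 := by
    rintro rfl
    simp at hp
    omega
  have hC : 0 < ∑ i, c i := sum_pos (fun i _ => hc i) univ_nonempty
  have hc' : ∀ i, 0 < c i / ∑ i, c i := fun i => div_pos (hc i) hC
  have hD : dualPolytope P = {x | ∀ i, inner ℝ (v i) x ≤ (1 : ℝ)} := by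
    ext x
    rw [hP, mem_dualPolytope_convexHull, Set.forall_mem_range]
    rfl
  have hiso := affinelyIsomorphic_simplexSection v (fun i => c i / ∑ i, c i) l
    (by rw [hcard, finrank_euclideanSpace_fin]) hspan hc'
    (by rw [← sum_div, div_self hC.ne'])
    (by simp only [div_eq_inv_mul, mul_smul]; rw [← smul_sum, hcv, smul_zero]) hl0 hl hlv
  rw [← hD] at hiso
  have h0 : (0 : EuclideanSpace ℝ (Fin n)) ∈ interior (dualPolytope P) := by
    have hopen : IsOpen {x | ∀ i, inner ℝ (v i) x < (1 : ℝ)} := by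
      rw [Set.ofPred_forall]
      exact isOpen_iInter_of_finite fun i => isOpen_lt (by fun_prop) continuous_const
    refine mem_interior.2 ⟨_, ?_, hopen, by simp⟩
    rw [hD]
    exact fun x hx i => (hx i).le
  refine ⟨⟨?_, ?_⟩, ι, _, fun i => l i / (c i / ∑ i, c i), hcard, ?_, ?_, ?_⟩
  · obtain ⟨V, hV⟩ := hiso.exists_eq_convexHull_of_simplexSection
    refine ⟨V, ?_, hV⟩
    rw [hV] at h0
    have := interior_subset h0
    rw [← coe_nonempty]
    exact convexHull_nonempty_iff.1 ⟨_, this⟩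
  · have htop := (convex_dualPolytope P).interior_nonempty_iff_affineSpan_eq_top.1 ⟨0, h0⟩
    rw [AffineSubspace.affineSpan_eq_top_iff_vectorSpan_eq_top_of_nonempty ℝ _ _
      ⟨0, interior_subset h0⟩] at htop
    rw [affDim, htop, finrank_top, finrank_euclideanSpace_fin]
  · rw [← hp]
    exact natCard_subtype_eq id Function.injective_id fun i => by
      simp [div_pos_iff_of_pos_right (hc' i)]
  · rw [← hq]
    exact natCard_subtype_eq id Function.injective_id fun i => by
      simp [div_neg_iff, hc' i, (hc' i).not_gt]
  · obtain ⟨e₁, -⟩ := hiso.exists_orderIso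
    obtain ⟨e₂⟩ := nonempty_orderIso_simplexSection fun i => l i / (c i / ∑ i, c i)
    exact ⟨e₁.trans e₂⟩

end GaleData

theorem mainTheorem4 (d s a : ℕ) (hd : 4 ≤ d) (hs : 2 ≤ s) (hsd : s + 2 ≤ d)
    (ha : a = (d + s) / 2 + 1) (k : ℕ) :
    -- the dual of `T_2^{d,d-a}` is a `d`-polytope
    IsPolytopeOfDim d (dualPolytope (polyT 2 d a)) ∧
    -- it, and every realisation of its combinatorial type, has `τ_k(2d+s-1,d)` faces of dimension `k`
    faceCount k (dualPolytope (polyT 2 d a)) = tau k d s ∧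
    (∀ (n : ℕ) (P : Set (EuclideanSpace ℝ (Fin n))), IsPolytopeOfDim d P →
      CombEquiv P (dualPolytope (polyT 2 d a)) → faceCount k P = tau k d s) ∧
    -- the two expressions for `τ_k(2d+s-1,d)` agree
    tau k d s = ((d + 2).choose (k + 2) : ℤ) - ((d - a + 3).choose (k + 2) : ℤ)
        - ((d - 1).choose (k + 2) : ℤ) + ((d - a + 1).choose (k + 2) : ℤ) ∧
    tau k d s = ((d + 1).choose (k + 1) : ℤ) + (d.choose (k + 1) : ℤ)
        + ((d - 1).choose (k + 1) : ℤ) - ((d - a + 2).choose (k + 1) : ℤ)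
        - ((d - a + 1).choose (k + 1) : ℤ) ∧
    -- the lower bound
    (∀ (n : ℕ) (Q : Set (EuclideanSpace ℝ (Fin n))), IsPolytopeOfDim d Q →
      faceCount (d - 1) Q = d + 2 → 2 * d + s - 1 ≤ faceCount 0 Q →
      tau k d s ≤ faceCount k Q) := by
  obtain ⟨hdual, ι, _, μ, hcard, hp, hq, ⟨e⟩⟩ :=
    (hasGaleData_polyT 2 d a).isPolytopeOfDim_dualPolytope (by omega)
  have hamb : 2 + (a - 2) + (d - a) = d := by omega
  have htau : tau k d s = galeFaceCount k d (2 + 1) (a - 2 + 1) := by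
    rw [tau_eq_galeFaceCount k d s a hs hsd ha, show a - 1 = a - 2 + 1 by omega]
  rw [hamb] at hcard
  have hpoly : IsPolytopeOfDim d (dualPolytope (polyT 2 d a)) := ⟨hdual.1, hdual.2.trans hamb⟩
  refine ⟨hpoly, ?_, ?_, by rw [ha]; rfl, tau_eq_choose_succ k d s a hs hsd ha, ?_⟩
  · rw [htau]
    exact faceCount_eq_galeFaceCount e hcard hpoly.2 hp hq (by omega) (by omega) k
  · rintro n P hP ⟨e'⟩
    rw [htau]
    exact faceCount_eq_galeFaceCount (e'.trans e) hcard hP.2 hp hq (by omega) (by omega) k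
  · intro n Q hQ hfac h0
    obtain ⟨p, q, hp1, hq1, hpq, hcount⟩ := exists_faceCount_eq_galeFaceCount (by omega) hQ hfac
    rw [hcount k]
    refine tau_le_galeFaceCount k d s p q hs hsd hp1 hq1 hpq ?_
    rw [← hcount 0]
    omega
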